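/- **Conventions.** Spaces are complex locally convex topological vector spaces, algebras have jointly continuous multiplication and need not be unital, and all linear and multilinear maps are continuous. A filtered superalgebra is a $\mathbb Z/2$-graded algebra $\Omega$ with graded subspaces $\Omega=F_0\Omega\supseteq F_{-1}\Omega\supseteq\cdots$ such that $F_{-k}\Omega\cdot F_{-l}\Omega\subseteq F_{-k-l}\Omega$; put $A=\Omega/F_{-1}\Omega$ and write $\partial a$ for the degree of $a$. A *cycle* $(\Omega,\nabla,\tau)$ with curvature $\omega$ consists of: - an odd derivation $\nabla$ of $\Omega$, i.e. $\nabla(ab)=(\nabla a)b+(-1)^{\partial a}a\nabla b$, with $\nabla(F_{-k}\Omega)\subseteq F_{-k-1}\Omega$; - an even multiplier $\omega=(l,r)$, i.e. even maps with $l(ab)=l(a)b$, $r(ab)=a\,r(b)$, $a\,l(b)=r(a)b$ (write $\omega a=l(a)$, $a\omega=r(a)$), such that $l$ and $r$ map $F_{-k}\Omega$ into $F_{-k-2}\Omega$, commute with $\nabla$, and satisfy $\nabla^2a=\omega a-a\omega$; - a linear map $\tau:\Omega\to\mathbb C$ with $\tau(ab)=(-1)^{\partial a\,\partial b}\tau(ba)$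 and $\tau(\nabla a)=0$. Let $\tilde\Omega=\Omega\oplus\Omega X\oplus X\Omega\oplus X\Omega X$, with $X$ a formal odd symbol and products $(aX)b=a(Xb)=0$, $(aX)(Xb)=a\omega b$. Let $d$ be the odd derivation with $da=\nabla a+Xa+(-1)^{\partial a}aX$ and $dX=0$, and let $$\tilde\tau(a_{00}+a_{01}X+Xa_{10}+Xa_{11}X)=\tau(a_{00})-(-1)^{\partial a_{11}}\tau(\omega a_{11}).$$ If $\tau(F_{-n-1}\Omega)=0$, the *cyclic cocycle associated to the cycle and $n$* is the functional on $A^{n+1}$ $$\varphi(a_0,\dots,a_n)=(-1)^{\mu}\,\tilde\tau\bigl(\rho(a_0)\,d\rho(a_1)\cdots d\rho(a_n)\bigr),\qquad \mu=\sum_{k}(n-k)\,\partial a_k,$$ where $\rho:A\to\Omega$ is any set-theoretic lifting. A cyclic $m$-cochain on $A$ is a continuous $(m+1)$-linear functional $f$ with $f(a_m,a_0,\dots,a_{m-1})=(-1)^{\nu+m}f(a_0,\dots,a_m)$, $\nu=\partial a_m(\partial a_0+\dots+\partial a_{m-1})$. The Hochschild coboundary is $$(bf)(a_0,\dots,a_{m+1})=\sum_{i=0}^{m}(-1)^if(\dots,a_ia_{i+1},\dots)+(-1)^{m+1+\nu'}f(a_{m+1}a_0,a_1,\dots,a_m),$$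 $\nu'=\partial a_{m+1}(\partial a_0+\dots+\partial a_m)$, and $HC^m(A)$ is the space of cyclic $m$-cochains $f$ with $bf=0$ modulo $b$ of the cyclic $(m-1)$-cochains. Connes' periodicity operator $S:HC^m(A)\to HC^{m+2}(A)$ is given on cyclic cocycles by $$(Sf)(a_0,\dots,a_{m+2})=\sum_{0\le i<j\le m+1}(-1)^{i+j+1}f(\dots,a_ia_{i+1},\dots,a_ja_{j+1},\dots),$$ where for $i=j-1$ the term is $f(\dots,a_{j-1}a_ja_{j+1},\dots)$. **Theorem.** Let $(\Omega,\nabla,\tau)$ be a cycle with curvature $\omega$, let $n\ge 0$ with $\tau(F_{-n-1}\Omega)=0$, and let $\eta\in F_{-1}\Omega$ be odd. Put $\nabla_1=\nabla+\mathrm{ad}_\eta$, where $\mathrm{ad}_\eta a=\eta a-(-1)^{\partial a}a\eta$. Then $(\Omega,\nabla_1,\tau)$, with curvature $\omega+\nabla\eta+\eta^2$, is a cycle. Let $\varphi_0$ and $\varphi_1$ be the functionals associated to $n$ and to $(\Omega,\nabla,\tau)$, respectively $(\Omega,\nabla_1,\tau)$, formed with arbitrary set-theoretic liftings. Then $\varphi_0$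 and $\varphi_1$ are cyclic $n$-cocycles on $A$, and $S\varphi_0=S\varphi_1$ in $HC^{n+2}(A)$. -/

import Mathlib

/-! ### Locally convex superalgebras -/

/-- A `ℤ/2`-grading on a complex topological algebra `A` (not necessarily unital) that is compatible
with products, encoded by its parity automorphism `a ↦ (-1)^{∂a} a`: the component of degree
`i mod 2` is the `(-1)^i`-eigenspace `{a | HasParity i a}`. -/
class SuperAlgebra (A : Type*) [NonUnitalRing A] [Module ℂ A] [TopologicalSpace A] where
  parity : A →L[ℂ] A
  parity_parity : ∀ a, parity (parity a) = a
  parity_mul : ∀ a b, parity (a * b) = parity a * parity b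

namespace SuperAlgebra

variable {A : Type*} [NonUnitalRing A] [Module ℂ A] [TopologicalSpace A] [SuperAlgebra A]

/-- `a` is homogeneous of degree `i mod 2`. -/
def HasParity (i : ℕ) (a : A) : Prop := parity a = (-1 : ℂ) ^ i • a

/-- The even component of `a`. -/
noncomputable def evenPart (a : A) : A := (2⁻¹ : ℂ) • (a + parity a)

/-- The odd component of `a`. -/
noncomputable def oddPart (a : A) : A := (2⁻¹ : ℂ) • (a - parity a)

theorem evenPart_add_oddPart (a : A) : evenPart a + oddPart a = a := by
  unfold evenPart oddPart
  rw [← smul_add, add_add_sub_cancel, ← two_smul ℂ a, smul_smul]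
  norm_num

theorem hasParity_evenPart (a : A) : HasParity 0 (evenPart a) := by
  simp [HasParity, evenPart, parity_parity, add_comm]

theorem hasParity_oddPart (a : A) : HasParity 1 (oddPart a) := by
  simp [HasParity, oddPart, parity_parity, ← smul_neg]

end SuperAlgebra

open SuperAlgebra

/-! ### Cyclic cohomology of a superalgebra (Connes' complex, continuous cochains) -/

namespace CyclicCohomology

variable (A : Type*) [NonUnitalRing A] [Module ℂ A] [TopologicalSpace A]

/-- Continuous `n`-cochains: the continuous `(n+1)`-linear functionals on `A`. -/
def cochains (n : ℕ) : Submodule ℂ ((Fin (n + 1) → A) → ℂ) where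
  carrier := {f | ∃ g : ContinuousMultilinearMap ℂ (fun _ : Fin (n + 1) => A) ℂ, ⇑g = f}
  add_mem' := by
    rintro _ _ ⟨g, rfl⟩ ⟨h, rfl⟩
    exact ⟨g + h, rfl⟩
  zero_mem' := ⟨0, rfl⟩
  smul_mem' := by
    rintro c _ ⟨g, rfl⟩
    exact ⟨c • g, rfl⟩

variable {A}

/-- The inner face `(a_0, …, a_{n+1}) ↦ (a_0, …, a_i a_{i+1}, …, a_{n+1})`. -/
def face {n : ℕ} (i : Fin (n + 1)) (a : Fin (n + 2) → A) : Fin (n + 1) → A :=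
  Fin.contractNth i.castSucc (· * ·) a

variable [SuperAlgebra A]

/-- The rotation with its Koszul sign: for a multilinear `f` this is the multilinear functional
whose value on homogeneous elements is `(-1)^ν f (a_n, a_0, …, a_{n-1})`, where
`ν = ∂a_n (∂a_0 + ⋯ + ∂a_{n-1})`; see `rotate_apply`. -/
noncomputable def rotate {n : ℕ} (f : (Fin (n + 1) → A) → ℂ) (a : Fin (n + 1) → A) : ℂ :=
  f (Fin.cons (evenPart (a (Fin.last n))) (Fin.init a)) +
    f (Fin.cons (oddPart (a (Fin.last n))) (fun k => parity (Fin.init a k)))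

theorem rotate_apply {n : ℕ} (f : MultilinearMap ℂ (fun _ : Fin (n + 1) => A) ℂ)
    (a : Fin (n + 1) → A) (p : Fin (n + 1) → ℕ) (h : ∀ k, HasParity (p k) (a k)) :
    rotate f a = (-1) ^ (p (Fin.last n) * ∑ k : Fin n, p k.castSucc) *
      f (Fin.cons (a (Fin.last n)) (Fin.init a)) := by
  have h2 : ∀ x : A, (2⁻¹ : ℂ) • (x + x) = x := fun x => by
    rw [← two_smul ℂ x, smul_smul]; norm_num
  have hl := h (Fin.last n)
  unfold HasParity at hl
  unfold rotate
  rcases Nat.even_or_odd (p (Fin.last n)) with hp | hp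
  · rw [hp.neg_one_pow, one_smul] at hl
    have e : evenPart (a (Fin.last n)) = a (Fin.last n) := by rw [evenPart, hl, h2]
    have o : oddPart (a (Fin.last n)) = 0 := by rw [oddPart, hl, sub_self, smul_zero]
    have z := f.map_coord_zero (m := Fin.cons 0 fun k => parity (Fin.init a k)) (0 : Fin (n + 1))
      (by simp)
    rw [e, o, z, (hp.mul_right _).neg_one_pow]
    ring
  · rw [hp.neg_one_pow, neg_one_smul] at hl
    have e : evenPart (a (Fin.last n)) = 0 := by rw [evenPart, hl, add_neg_cancel, smul_zero]
    have o : oddPart (a (Fin.last n)) = a (Fin.last n) := by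
      rw [oddPart, hl, sub_neg_eq_add, h2]
    have z := f.map_coord_zero (m := Fin.cons 0 (Fin.init a)) (0 : Fin (n + 1)) (by simp)
    rw [e, o, z, zero_add, pow_mul, hp.neg_one_pow]
    have key := f.map_smul_univ (Fin.cons 1 (fun k : Fin n => (-1 : ℂ) ^ p k.castSucc))
      (Fin.cons (a (Fin.last n)) (Fin.init a))
    rw [Fin.prod_univ_succ] at key
    simp only [Fin.cons_zero, Fin.cons_succ, one_mul, Finset.prod_pow_eq_pow_sum, smul_eq_mul]
      at key
    rw [← key]
    congr 1
    funext k
    refine Fin.cases ?_ (fun k => ?_) k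
    · simp
    · exact h k.castSucc

/-- The Hochschild coboundary: on homogeneous elements
`(b f)(a_0, …, a_{n+1}) = ∑_{i ≤ n} (-1)^i f (a_0, …, a_i a_{i+1}, …, a_{n+1})
  + (-1)^{n+1+ν} f (a_{n+1} a_0, a_1, …, a_n)`, where `ν = ∂a_{n+1} (∂a_0 + ⋯ + ∂a_n)`. -/
noncomputable def b {n : ℕ} : ((Fin (n + 1) → A) → ℂ) →ₗ[ℂ] ((Fin (n + 2) → A) → ℂ) where
  toFun f a := ∑ i : Fin (n + 1), (-1) ^ (i : ℕ) * f (face i a) +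
    (-1) ^ (n + 1) * rotate (fun c => f (face 0 c)) a
  map_add' f g := by
    funext a
    simp only [Pi.add_apply, rotate, mul_add, Finset.sum_add_distrib]
    ring
  map_smul' c f := by
    funext a
    simp only [Pi.smul_apply, rotate, smul_eq_mul, RingHom.id_apply, mul_add, Finset.mul_sum]
    congr 1
    · exact Finset.sum_congr rfl fun i _ => by ring
    · ring

variable (A)

/-- Cyclic `n`-cochains: continuous multilinear `f` with
`f (a_n, a_0, …, a_{n-1}) = (-1)^{ν+n} f (a_0, …, a_n)`. -/
noncomputable def cyclicCochains (n : ℕ) : Submodule ℂ ((Fin (n + 1) → A) → ℂ) where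
  carrier := {f | f ∈ cochains A n ∧ rotate f = (-1 : ℂ) ^ n • f}
  add_mem' := by
    rintro f g ⟨hf, hf'⟩ ⟨hg, hg'⟩
    refine ⟨add_mem hf hg, ?_⟩
    rw [smul_add, ← hf', ← hg']
    funext a
    simp only [rotate, Pi.add_apply]
    ring
  zero_mem' := ⟨zero_mem _, by funext a; simp [rotate]⟩
  smul_mem' := by
    rintro c f ⟨hf, hf'⟩
    refine ⟨Submodule.smul_mem _ c hf, ?_⟩
    rw [smul_comm, ← hf']
    funext a
    simp only [rotate, Pi.smul_apply, smul_eq_mul]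
    ring

/-- Cyclic cocycles of order `n`. -/
noncomputable def cyclicCocycles (n : ℕ) : Submodule ℂ ((Fin (n + 1) → A) → ℂ) :=
  cyclicCochains A n ⊓ LinearMap.ker (b (A := A) (n := n))

/-- The Hochschild coboundaries of cyclic cochains. -/
noncomputable def cyclicCoboundaries : (n : ℕ) → Submodule ℂ ((Fin (n + 1) → A) → ℂ)
  | 0 => ⊥
  | n + 1 => (cyclicCochains A n).map b

/-- The cyclic cohomology group `HC^n(A)`. -/
abbrev HC (n : ℕ) : Type _ :=
  cyclicCocycles A n ⧸ (cyclicCoboundaries A n).submoduleOf (cyclicCocycles A n)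

variable {A}

/-- The class in `HC^n(A)` of a cyclic cocycle. -/
noncomputable def HC.mk {n : ℕ} (f : (Fin (n + 1) → A) → ℂ) (hf : f ∈ cyclicCocycles A n) :
    HC A n :=
  Submodule.Quotient.mk ⟨f, hf⟩

/-- Connes' periodicity operator `S` on cyclic cocycles, i.e. the product with the generator of
`HC^2(ℂ)`:
`(S φ)(a_0, …, a_{n+2}) = ∑_{j=1}^{n+1} φ^(a_0 da_1 ⋯ da_{j-1} (a_j a_{j+1}) da_{j+2} ⋯ da_{n+2})`,
where `φ^` is the closed graded trace on the universal differential algebra with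
`φ^(a_0 da_1 ⋯ da_n) = φ(a_0, …, a_n)` (in the graded case both sides carry the usual signs).
Moving `a_j a_{j+1}` to the left through the differentials by the Leibniz rule gives the sum
of `(-1)^{j-1-i} φ(…, a_i a_{i+1}, …, a_j a_{j+1}, …)` over `i < j`, where the term `i = j - 1` is
`φ(…, a_{j-1} a_j a_{j+1}, …)`. No element changes its place, so no Koszul sign occurs. -/
def S {n : ℕ} (f : (Fin (n + 1) → A) → ℂ) (a : Fin (n + 3) → A) : ℂ :=
  ∑ j : Fin (n + 2), ∑ i : Fin (n + 1),
    if (i : ℕ) < j then (-1) ^ ((i : ℕ) + j + 1) * f (face i (face j a)) else 0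

end CyclicCohomology

/-! ### Filtered superalgebras, chains and cycles -/

section Cycles

variable (Ω : Type*) [NonUnitalRing Ω] [Module ℂ Ω] [TopologicalSpace Ω] [SuperAlgebra Ω]

/-- A filtration `Ω = F_0 Ω ⊇ F_{-1} Ω ⊇ ⋯` of a superalgebra by graded subspaces, with
`F_{-k} Ω · F_{-l} Ω ⊆ F_{-k-l} Ω`. Here `F k` is `F_{-k} Ω`. -/
structure SuperFiltration where
  F : ℕ → Submodule ℂ Ω
  F_zero : F 0 = ⊤
  anti : Antitone F
  parity_mem : ∀ k, ∀ a ∈ F k, parity a ∈ F k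
  mul_mem : ∀ k l, ∀ a ∈ F k, ∀ b ∈ F l, a * b ∈ F (k + l)

variable {Ω}

namespace SuperFiltration

theorem mul_mem_one_left (𝓕 : SuperFiltration Ω) {a : Ω} (ha : a ∈ 𝓕.F 1) (b : Ω) :
    a * b ∈ 𝓕.F 1 :=
  𝓕.mul_mem 1 0 a ha b (by rw [𝓕.F_zero]; trivial)

theorem mul_mem_one_right (𝓕 : SuperFiltration Ω) (a : Ω) {b : Ω} (hb : b ∈ 𝓕.F 1) :
    a * b ∈ 𝓕.F 1 := by
  simpa using 𝓕.mul_mem 0 1 a (by rw [𝓕.F_zero]; trivial) b hb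

/-- The superalgebra `A = Ω / F_{-1} Ω`, with the quotient topology. -/
def A (𝓕 : SuperFiltration Ω) : Type _ := Ω ⧸ 𝓕.F 1

/-- The projection `Ω → Ω / F_{-1} Ω`. -/
def proj (𝓕 : SuperFiltration Ω) (a : Ω) : 𝓕.A := Submodule.Quotient.mk (p := 𝓕.F 1) a

theorem proj_surjective (𝓕 : SuperFiltration Ω) : Function.Surjective 𝓕.proj :=
  Submodule.Quotient.mk_surjective _

instance (𝓕 : SuperFiltration Ω) : AddCommGroup 𝓕.A :=
  inferInstanceAs (AddCommGroup (Ω ⧸ 𝓕.F 1))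

instance (𝓕 : SuperFiltration Ω) : Mul 𝓕.A where
  mul := Quotient.map₂ (· * ·) (by
    intro a a' ha c c' hc
    replace ha := (Submodule.quotientRel_def _).1 ha
    replace hc := (Submodule.quotientRel_def _).1 hc
    refine (Submodule.quotientRel_def _).2 ?_
    have h := add_mem (𝓕.mul_mem_one_left ha c) (𝓕.mul_mem_one_right a' hc)
    simpa [sub_mul, mul_sub] using h)

theorem proj_mul (𝓕 : SuperFiltration Ω) (a b : Ω) : 𝓕.proj (a * b) = 𝓕.proj a * 𝓕.proj b := rfl

theorem proj_add (𝓕 : SuperFiltration Ω) (a b : Ω) : 𝓕.proj (a + b) = 𝓕.proj a + 𝓕.proj b := rfl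

theorem proj_zero (𝓕 : SuperFiltration Ω) : 𝓕.proj 0 = 0 := rfl

instance (𝓕 : SuperFiltration Ω) : NonUnitalRing 𝓕.A where
  left_distrib := by
    intro x y z
    obtain ⟨a, rfl⟩ := 𝓕.proj_surjective x
    obtain ⟨b, rfl⟩ := 𝓕.proj_surjective y
    obtain ⟨c, rfl⟩ := 𝓕.proj_surjective z
    simp only [← proj_mul, ← proj_add, mul_add]
  right_distrib := by
    intro x y z
    obtain ⟨a, rfl⟩ := 𝓕.proj_surjective x
    obtain ⟨b, rfl⟩ := 𝓕.proj_surjective y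
    obtain ⟨c, rfl⟩ := 𝓕.proj_surjective z
    simp only [← proj_mul, ← proj_add, add_mul]
  zero_mul := by
    intro x
    obtain ⟨a, rfl⟩ := 𝓕.proj_surjective x
    simp only [← proj_zero, ← proj_mul, zero_mul]
  mul_zero := by
    intro x
    obtain ⟨a, rfl⟩ := 𝓕.proj_surjective x
    simp only [← proj_zero, ← proj_mul, mul_zero]
  mul_assoc := by
    intro x y z
    obtain ⟨a, rfl⟩ := 𝓕.proj_surjective x
    obtain ⟨b, rfl⟩ := 𝓕.proj_surjective y
    obtain ⟨c, rfl⟩ := 𝓕.proj_surjective z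
    simp only [← proj_mul, mul_assoc]

instance (𝓕 : SuperFiltration Ω) : Module ℂ 𝓕.A :=
  inferInstanceAs (Module ℂ (Ω ⧸ 𝓕.F 1))

instance (𝓕 : SuperFiltration Ω) : TopologicalSpace 𝓕.A :=
  inferInstanceAs (TopologicalSpace (Ω ⧸ 𝓕.F 1))

instance (𝓕 : SuperFiltration Ω) : SuperAlgebra 𝓕.A where
  parity :=
    { toLinearMap := (𝓕.F 1).mapQ (𝓕.F 1) (parity : Ω →L[ℂ] Ω).toLinearMap
        (fun a ha => 𝓕.parity_mem 1 a ha)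
      cont := (continuous_quot_mk.comp (parity : Ω →L[ℂ] Ω).continuous).quotient_lift _ }
  parity_parity := by
    intro x
    obtain ⟨a, rfl⟩ := 𝓕.proj_surjective x
    exact congrArg 𝓕.proj (parity_parity a)
  parity_mul := by
    intro x y
    obtain ⟨a, rfl⟩ := 𝓕.proj_surjective x
    obtain ⟨b, rfl⟩ := 𝓕.proj_surjective y
    exact congrArg 𝓕.proj (parity_mul a b)

end SuperFiltration

/-- A chain `(Ω, ∇, τ)`: an odd connection `∇` of filtration degree `-1` and a supertrace `τ` on the
filtered superalgebra `Ω`. The curvature `ω` is the multiplier `(l, r) = (curvL, curvR)`; it is even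
and belongs to `F_{-2}`, i.e. it lowers the filtration by two. As the curvature is in general not
determined by `∇`, it is part of the data. -/
structure NCChain (𝓕 : SuperFiltration Ω) where
  nabla : Ω →L[ℂ] Ω
  nabla_odd : ∀ i a, HasParity i a → HasParity (i + 1) (nabla a)
  nabla_mul : ∀ i a b, HasParity i a →
    nabla (a * b) = nabla a * b + (-1 : ℂ) ^ i • (a * nabla b)
  nabla_mem : ∀ k, ∀ a ∈ 𝓕.F k, nabla a ∈ 𝓕.F (k + 1)
  curvL : Ω →L[ℂ] Ω
  curvR : Ω →L[ℂ] Ω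
  curvL_mul : ∀ a b, curvL (a * b) = curvL a * b
  curvR_mul : ∀ a b, curvR (a * b) = a * curvR b
  mul_curvL : ∀ a b, a * curvL b = curvR a * b
  curvL_even : ∀ i a, HasParity i a → HasParity i (curvL a)
  curvR_even : ∀ i a, HasParity i a → HasParity i (curvR a)
  curvL_mem : ∀ k, ∀ a ∈ 𝓕.F k, curvL a ∈ 𝓕.F (k + 2)
  curvR_mem : ∀ k, ∀ a ∈ 𝓕.F k, curvR a ∈ 𝓕.F (k + 2)
  nabla_nabla : ∀ a, nabla (nabla a) = curvL a - curvR a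
  nabla_curvL : ∀ a, nabla (curvL a) = curvL (nabla a)
  nabla_curvR : ∀ a, nabla (curvR a) = curvR (nabla a)
  tau : Ω →L[ℂ] ℂ
  tau_mul_comm : ∀ i j a b, HasParity i a → HasParity j b →
    tau (a * b) = (-1) ^ (i * j) * tau (b * a)

/-- A cycle is a chain whose supertrace is closed. -/
structure NCCycle (𝓕 : SuperFiltration Ω) extends NCChain 𝓕 where
  tau_nabla : ∀ a, tau (nabla a) = 0

/-- The space `Ω~ = Ω ⊕ ΩX ⊕ XΩ ⊕ XΩX`; the element with components `c00, c01, c10, c11` is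
`c00 + c01 X + X c10 + X c11 X`, where `X` is a formal odd symbol. -/
@[ext]
structure Tilde (Ω : Type*) where
  c00 : Ω
  c01 : Ω
  c10 : Ω
  c11 : Ω

namespace NCChain

variable {𝓕 : SuperFiltration Ω} (C : NCChain 𝓕)

/-- The inclusion `Ω → Ω~`. -/
def incl (a : Ω) : Tilde Ω := ⟨a, 0, 0, 0⟩

/-- The product of `Ω~`, given by `(aX)b = a(Xb) = 0` and `(aX)(Xb) = aωb`. -/
def tildeMul (u v : Tilde Ω) : Tilde Ω where
  c00 := u.c00 * v.c00 + u.c01 * C.curvL v.c10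
  c01 := u.c00 * v.c01 + u.c01 * C.curvL v.c11
  c10 := u.c10 * v.c00 + u.c11 * C.curvL v.c10
  c11 := u.c10 * v.c01 + u.c11 * C.curvL v.c11

/-- The differential of `Ω~`: the odd derivation with `da = ∇a + Xa + (-1)^{∂a} aX` and `dX = 0`,
so that `d(aX) = (da)X`, `d(Xa) = -X(da)` and `d(XaX) = -X(da)X`, where `XXa = ωa`, `aXX = aω`. -/
def tildeD (u : Tilde Ω) : Tilde Ω where
  c00 := C.nabla u.c00 + parity (C.curvR u.c01) - C.curvL u.c10
  c01 := parity u.c00 + C.nabla u.c01 - C.curvL u.c11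
  c10 := u.c00 - C.nabla u.c10 - parity (C.curvR u.c11)
  c11 := u.c01 - parity u.c10 - C.nabla u.c11

/-- The supertrace of `Ω~`:
`a_00 + a_01 X + X a_10 + X a_11 X ↦ τ(a_00) - (-1)^{∂a_11} τ(ω a_11)`. -/
noncomputable def tildeTau (u : Tilde Ω) : ℂ := C.tau u.c00 - C.tau (C.curvL (parity u.c11))

/-- The element `a_0 da_1 ⋯ da_n` of `Ω~`. -/
def form : (n : ℕ) → (Fin (n + 1) → Ω) → Tilde Ω
  | 0, a => incl (a 0)
  | n + 1, a => C.tildeMul (form n (Fin.init a)) (C.tildeD (incl (a (Fin.last (n + 1)))))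

/-- The functional `(-1)^μ τ~(a_0 da_1 ⋯ da_n)`, where
`μ = ∑_k (n - k) ∂a_k ≡ ∂a_{n-1} + ∂a_{n-3} + ⋯ mod 2`; the sign is inserted by applying the
parity automorphism `n - k` times to `a_k`. -/
noncomputable def character (n : ℕ) (a : Fin (n + 1) → Ω) : ℂ :=
  C.tildeTau (C.form n fun k => (⇑(parity : Ω →L[ℂ] Ω))^[n - (k : ℕ)] (a k))

/-- The functional `φ(a_0, …, a_n) = (-1)^μ τ~(ρ(a_0) dρ(a_1) ⋯ dρ(a_n))` on `A = Ω / F_{-1} Ω`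
associated to the chain, `n` and the set theoretic lifting `ρ : A → Ω`. -/
noncomputable def cocycle (n : ℕ) (ρ : 𝓕.A → Ω) (x : Fin (n + 1) → 𝓕.A) : ℂ :=
  C.character n fun k => ρ (x k)

/-! #### The connection `∇ + ad_η` -/

theorem nabla_parity (a : Ω) : C.nabla (parity a) = -parity (C.nabla a) := by
  have h0 := C.nabla_odd _ _ (hasParity_evenPart a)
  have h1 := C.nabla_odd _ _ (hasParity_oddPart a)
  have e0 := hasParity_evenPart a
  have e1 := hasParity_oddPart a
  rw [← evenPart_add_oddPart a]
  unfold HasParity at *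
  simp only [map_add, h0, h1, e0, e1]
  simp
  abel

theorem nabla_mul_parity (a b : Ω) : C.nabla (a * b) = C.nabla a * b + parity a * C.nabla b := by
  have h0 := C.nabla_mul _ _ b (hasParity_evenPart a)
  have h1 := C.nabla_mul _ _ b (hasParity_oddPart a)
  have e0 := hasParity_evenPart a
  have e1 := hasParity_oddPart a
  rw [← evenPart_add_oddPart a]
  unfold HasParity at e0 e1
  simp only [map_add, add_mul, h0, h1, e0, e1]
  simp
  abel

theorem curvL_parity (a : Ω) : C.curvL (parity a) = parity (C.curvL a) := by
  have h0 := C.curvL_even _ _ (hasParity_evenPart a)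
  have h1 := C.curvL_even _ _ (hasParity_oddPart a)
  have e0 := hasParity_evenPart a
  have e1 := hasParity_oddPart a
  rw [← evenPart_add_oddPart a]
  unfold HasParity at *
  simp only [map_add, h0, h1, e0, e1]
  simp

theorem curvR_parity (a : Ω) : C.curvR (parity a) = parity (C.curvR a) := by
  have h0 := C.curvR_even _ _ (hasParity_evenPart a)
  have h1 := C.curvR_even _ _ (hasParity_oddPart a)
  have e0 := hasParity_evenPart a
  have e1 := hasParity_oddPart a
  rw [← evenPart_add_oddPart a]
  unfold HasParity at *
  simp only [map_add, h0, h1, e0, e1]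
  simp

end NCChain

namespace NCCycle

/-- Left multiplication by `x`. -/
def mulL {B : Type*} [NonUnitalRing B] [Module ℂ B] [SMulCommClass ℂ B B] [TopologicalSpace B]
    [IsTopologicalRing B] (x : B) : B →L[ℂ] B :=
  { toLinearMap := LinearMap.mulLeft ℂ x
    cont := continuous_const.mul continuous_id }

/-- Right multiplication by `x`. -/
def mulR {B : Type*} [NonUnitalRing B] [Module ℂ B] [IsScalarTower ℂ B B] [TopologicalSpace B]
    [IsTopologicalRing B] (x : B) : B →L[ℂ] B :=
  { toLinearMap := LinearMap.mulRight ℂ x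
    cont := continuous_id.mul continuous_const }

@[simp] theorem mulL_apply {B : Type*} [NonUnitalRing B] [Module ℂ B] [SMulCommClass ℂ B B]
    [TopologicalSpace B] [IsTopologicalRing B] (x a : B) : mulL x a = x * a := rfl

@[simp] theorem mulR_apply {B : Type*} [NonUnitalRing B] [Module ℂ B] [IsScalarTower ℂ B B]
    [TopologicalSpace B] [IsTopologicalRing B] (x a : B) : mulR x a = a * x := rfl

theorem perturb_nabla_odd {η : Ω} (ho : HasParity 1 η) {i : ℕ} {a c : Ω} (ha : HasParity i a)
    (hc : HasParity (i + 1) c) : HasParity (i + 1) (c + (η * a - parity a * η)) := by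
  unfold HasParity at *
  rw [map_add, map_sub, parity_mul, parity_mul, ho, hc, ha, map_smul, ha]
  rcases neg_one_pow_eq_or ℂ i with h | h <;> simp [pow_succ, h] <;> abel

variable {𝓕 : SuperFiltration Ω} [IsScalarTower ℂ Ω Ω] [SMulCommClass ℂ Ω Ω] [IsTopologicalRing Ω]

/-- The cycle `(Ω, ∇ + ad_η, τ)`, for an odd `η ∈ F_{-1} Ω`, where `ad_η a = η a - (-1)^{∂a} a η`.
Its curvature is `ω + ∇η + η²`, acting by left and right multiplication. -/
noncomputable def perturb (C : NCCycle 𝓕) (η : Ω) (hη : η ∈ 𝓕.F 1) (ho : HasParity 1 η) :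
    NCCycle 𝓕 where
  nabla := C.nabla + (mulL η - (mulR η).comp parity)
  curvL := C.curvL + mulL (C.nabla η + η * η)
  curvR := C.curvR + mulR (C.nabla η + η * η)
  tau := C.tau
  tau_mul_comm := C.tau_mul_comm
  nabla_odd := by
    intro i a ha
    exact perturb_nabla_odd ho ha (C.nabla_odd i a ha)
  nabla_mul := by
    intro i a b ha
    have h := C.nabla_mul i a b ha
    unfold HasParity at ha
    simp only [add_apply, sub_apply, mulL_apply,
      ContinuousLinearMap.comp_apply, mulR_apply, parity_mul, h, ha, mul_add, mul_sub, add_mul,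
      sub_mul, smul_add, smul_sub, smul_mul_assoc, mul_assoc]
    abel
  nabla_mem := by
    intro k a ha
    refine add_mem (C.nabla_mem k a ha) (sub_mem ?_ (𝓕.mul_mem k 1 _ (𝓕.parity_mem k a ha) η hη))
    have := 𝓕.mul_mem 1 k η hη a ha
    rwa [add_comm] at this
  curvL_mul := by
    intro a b
    simp [C.curvL_mul, add_mul, mul_assoc]
  curvR_mul := by
    intro a b
    simp [C.curvR_mul, mul_add, mul_assoc]
  mul_curvL := by
    intro a b
    simp [C.mul_curvL, mul_add, add_mul, mul_assoc]
  curvL_even := by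
    intro i a ha
    have h1 := C.curvL_even i a ha
    have h2 := C.nabla_odd 1 η ho
    unfold HasParity at *
    rcases neg_one_pow_eq_or ℂ i with h | h <;> simp [h1, h2, parity_mul, ha, ho, h, add_mul]
  curvR_even := by
    intro i a ha
    have h1 := C.curvR_even i a ha
    have h2 := C.nabla_odd 1 η ho
    unfold HasParity at *
    rcases neg_one_pow_eq_or ℂ i with h | h <;> simp [h1, h2, parity_mul, ha, ho, h, mul_add]
  curvL_mem := by
    intro k a ha
    have h2 : C.nabla η + η * η ∈ 𝓕.F 2 := add_mem (C.nabla_mem 1 η hη) (𝓕.mul_mem 1 1 η hη η hη)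
    have := 𝓕.mul_mem 2 k _ h2 a ha
    rw [add_comm] at this
    exact add_mem (C.curvL_mem k a ha) this
  curvR_mem := by
    intro k a ha
    have h2 : C.nabla η + η * η ∈ 𝓕.F 2 := add_mem (C.nabla_mem 1 η hη) (𝓕.mul_mem 1 1 η hη η hη)
    exact add_mem (C.curvR_mem k a ha) (𝓕.mul_mem k 2 a ha _ h2)
  nabla_nabla := by
    intro a
    have ho' : parity η = -η := by simpa [HasParity] using ho
    simp only [add_apply, sub_apply, mulL_apply,
      ContinuousLinearMap.comp_apply, mulR_apply, map_add, map_sub, C.nabla_nabla,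
      C.nabla_mul_parity, C.nabla_parity, parity_mul, parity_parity, ho', mul_add, add_mul,
      neg_mul, mul_neg, mul_assoc]
    abel
  nabla_curvL := by
    intro a
    have ho' : parity η = -η := by simpa [HasParity] using ho
    have e := C.mul_curvL
    have h2 := C.nabla_odd 1 η ho
    simp only [HasParity, one_add_one_eq_two, even_two, Even.neg_pow, one_pow, one_smul] at h2
    simp only [add_apply, sub_apply, mulL_apply,
      ContinuousLinearMap.comp_apply, mulR_apply, map_add, map_sub, C.nabla_nabla,
      C.nabla_mul_parity, parity_mul, ho', mul_add,
      add_mul, sub_mul, neg_mul, mul_neg, mul_assoc, C.nabla_curvL, C.curvL_mul, e,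
      C.curvL_parity, h2]
    abel
  nabla_curvR := by
    intro a
    have ho' : parity η = -η := by simpa [HasParity] using ho
    have e := C.mul_curvL
    have h2 := C.nabla_odd 1 η ho
    simp only [HasParity, one_add_one_eq_two, even_two, Even.neg_pow, one_pow, one_smul] at h2
    simp only [add_apply, sub_apply, mulL_apply,
      ContinuousLinearMap.comp_apply, mulR_apply, map_add, map_sub, C.nabla_nabla,
      C.nabla_mul_parity, parity_mul, ho', mul_add, mul_sub,
      neg_mul, mul_neg, mul_assoc, C.nabla_curvR, C.curvR_mul, e,
      ← C.curvR_parity, h2]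
    abel
  tau_nabla := by
    intro a
    have h := C.tau_nabla a
    have h0 := C.tau_mul_comm _ _ _ _ ho (hasParity_evenPart a)
    have h1 := C.tau_mul_comm _ _ _ _ ho (hasParity_oddPart a)
    have e0 := hasParity_evenPart a
    have e1 := hasParity_oddPart a
    unfold HasParity at e0 e1
    have key : C.tau (η * a) = C.tau (parity a * η) := by
      rw [← evenPart_add_oddPart a]
      simp only [mul_add, add_mul, map_add, h0, h1, e0, e1]
      simp
    simp [h, key]

end NCCycle

end Cycles

/-! ### Alternating sums of contractions of tuples -/

/-! Join the two cycles by the cycles with connection `∇ + t ad_η` and the same trace. Their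
cocycles φ_t are polynomial in t. A polynomial whose derivative stays in a subspace changes only by
elements of it (`PolyDeriv.sub_mem`), so it suffices that S φ_t' is the coboundary of a cyclic
cochain for each t.

The derivative. The form a_0 da_1 ⋯ da_n arises from a_0 by right multiplications by da_i. They are
encoded as operators `step a_i` on pairs (p, q), where p is the component in Ω and q is the
coefficient of X after multiplication by ω, up to sign and parity. These operators satisfy a Leibniz
rule (`step_mul`) and anticommute with an operator `conn` made of ∇ and ω (`conn_mul_step`). With
the trace property and τ∘∇ = 0 this gives cyclic cocycles. The variation of `step a` along `ad_η` is
a commutator with the insertion `slot η` plus a commutator with `conn` (`dstep_eq`). Consequently φ'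
is the sum of all rotations of one cochain g, which starts from (0, â_0 η) instead of (a_0, 0)
(`dfunctional_eq_sum`), and (b g)(a_0, …) = g(a_0 a_1, a_2, …).

The periodicity operator. Let b' be the sum over inner contractions (`bar`), w its weighted version
(`wbar`) and λ the signed rotation (`lam`). For a cyclic cocycle f one has S f = b(w f) and (1 - λ)
w f = (n + 2) b' f, so w f is a primitive that fails to be cyclic. If f is the sum of the rotations
of g, some k satisfies (1 - λ) k = f - (n + 1) g. Together with (1 - λ) b = b'(1 - λ) and b' g = (1
- λ) b g this gives b' f = (1 - λ)(b k + (n + 1) b g). Subtracting (n + 2)(b k + (n + 1) b g) makes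
w f cyclic and leaves its coboundary unchanged, because b² = 0 (`bibar_eq_tb_cyclic`).

Signs and descent. Split τ into homogeneous parts. A cochain of degree q sees only homogeneous
arguments of total degree q, so moving a_n to the front costs (-1)^((q + 1) ∂a_n), which depends on
a_n alone. The graded theory thus becomes an ungraded one twisted by an involution σ. The
functionals descend to `A` because n differentials together with one argument in F_{-1} land in
F_{-n-1}, where τ vanishes. -/

namespace TwistedCyclic

section Contract

variable {A : Type*}

/-- The tuple `(x, l)`. -/
abbrev tcons {m : ℕ} (x : A) (l : Fin m → A) : Fin (m + 1) → A := Fin.cons x l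

/-- The tuple `(l, z)`. -/
abbrev tsnoc {m : ℕ} (l : Fin m → A) (z : A) : Fin (m + 1) → A := Fin.snoc l z

theorem tcons_head_tail {m : ℕ} (a : Fin (m + 1) → A) : tcons (a 0) (Fin.tail a) = a :=
  Fin.cons_self_tail a

theorem tsnoc_init_last {m : ℕ} (a : Fin (m + 1) → A) :
    tsnoc (Fin.init a) (a (Fin.last m)) = a :=
  Fin.snoc_init_self a

theorem tcons_zero {m : ℕ} (x : A) (l : Fin m → A) : tcons x l 0 = x := rfl

theorem tail_tcons {m : ℕ} (x : A) (l : Fin m → A) : Fin.tail (tcons x l) = l := rfl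

theorem tsnoc_last {m : ℕ} (l : Fin m → A) (z : A) : tsnoc l z (Fin.last m) = z :=
  Fin.snoc_last (α := fun _ => A) z l

theorem init_tsnoc {m : ℕ} (l : Fin m → A) (z : A) : Fin.init (tsnoc l z) = l :=
  Fin.init_snoc (α := fun _ => A) z l

theorem exists_tcons {m : ℕ} (a : Fin (m + 1) → A) : ∃ x l, tcons x l = a :=
  ⟨_, _, tcons_head_tail a⟩

theorem exists_tsnoc {m : ℕ} (a : Fin (m + 1) → A) : ∃ l z, tsnoc l z = a :=
  ⟨_, _, tsnoc_init_last a⟩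

theorem tcons_tsnoc {m : ℕ} (x : A) (l : Fin m → A) (z : A) :
    tcons x (tsnoc l z) = tsnoc (tcons x l) z :=
  Fin.cons_snoc_eq_snoc_cons (β := A) x l z

theorem init_tcons {m : ℕ} (x : A) (l : Fin (m + 1) → A) :
    (Fin.init (tcons x l) : Fin (m + 1) → A) = tcons x (Fin.init l) := by
  obtain ⟨l, z, rfl⟩ := exists_tsnoc l
  rw [tcons_tsnoc, Fin.init_snoc, Fin.init_snoc]

theorem tail_tsnoc {m : ℕ} (l : Fin (m + 1) → A) (z : A) :
    (Fin.tail (tsnoc l z) : Fin (m + 1) → A) = tsnoc (Fin.tail l) z := by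
  obtain ⟨x, l, rfl⟩ := exists_tcons l
  rw [← tcons_tsnoc, Fin.tail_cons, Fin.tail_cons]

variable [Mul A]

/-- The tuple in which the neighbours with indices `j` and `j + 1` are multiplied. -/
abbrev contract {m : ℕ} (j : Fin (m + 1)) (a : Fin (m + 1) → A) : Fin m → A :=
  Fin.contractNth j (· * ·) a

theorem contract_zero {m : ℕ} (x y : A) (l : Fin m → A) :
    contract 0 (tcons x (tcons y l)) = tcons (x * y) l := by
  funext k
  refine Fin.cases ?_ (fun k => ?_) k
  · rw [contract, Fin.contractNth_apply_of_eq _ _ _ _ rfl]; rfl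
  · rw [contract, Fin.contractNth_apply_of_gt _ _ _ _ (by simp)]; rfl

theorem contract_succ {m : ℕ} (i : Fin (m + 1)) (x : A) (l : Fin (m + 1) → A) :
    contract i.succ (tcons x l) = tcons x (contract i l) := by
  funext k
  refine Fin.cases ?_ (fun k => ?_) k
  · rw [contract, Fin.contractNth_apply_of_lt _ _ _ _ (by simp)]; rfl
  · simp only [contract, Fin.cons_succ]
    rcases lt_trichotomy (k : ℕ) i with h | h | h
    · rw [Fin.contractNth_apply_of_lt _ _ _ _ h, Fin.contractNth_apply_of_lt _ _ _ _ (by simpa)]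
      rfl
    · rw [Fin.contractNth_apply_of_eq _ _ _ _ h, Fin.contractNth_apply_of_eq _ _ _ _ (by simpa)]
      rfl
    · rw [Fin.contractNth_apply_of_gt _ _ _ _ h, Fin.contractNth_apply_of_gt _ _ _ _ (by simpa)]
      rfl

theorem contract_castSucc_tsnoc {m : ℕ} (i : Fin m) (l : Fin (m + 1) → A) (z : A) :
    contract i.castSucc.castSucc (tsnoc l z) = tsnoc (contract i.castSucc l) z := by
  induction m with
  | zero => exact i.elim0
  | succ m ih =>
    obtain ⟨x, l, rfl⟩ := exists_tcons l
    rw [← tcons_tsnoc]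
    refine Fin.cases ?_ (fun i => ?_) i
    · obtain ⟨y, l, rfl⟩ := exists_tcons l
      rw [← tcons_tsnoc]
      simp only [Fin.castSucc_zero]
      rw [contract_zero, contract_zero, tcons_tsnoc]
    · rw [← Fin.succ_castSucc, ← Fin.succ_castSucc, contract_succ, ih, contract_succ, tcons_tsnoc]

theorem contract_last_tsnoc {m : ℕ} (l : Fin m → A) (y z : A) :
    contract (Fin.last m).castSucc (tsnoc (tsnoc l y) z) = tsnoc l (y * z) := by
  induction m with
  | zero =>
    funext k
    rw [Fin.fin_one_eq_zero k, contract, Fin.contractNth_apply_of_eq _ _ _ _ rfl]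
    rfl
  | succ m ih =>
    obtain ⟨x, l, rfl⟩ := exists_tcons l
    rw [← tcons_tsnoc, ← tcons_tsnoc, ← Fin.succ_last, ← Fin.succ_castSucc, contract_succ, ih,
      tcons_tsnoc]

/-! ### The bar coboundary, its weighted version and double contractions. -/

section Bar

variable {V : Type*} [AddCommGroup V] [Module ℂ V]

/-- The coboundary of the bar complex: the alternating sum over all contractions. -/
noncomputable def bar {m : ℕ} (f : (Fin m → A) → V) (a : Fin (m + 1) → A) : V :=
  ∑ i : Fin m, (-1 : ℂ) ^ (i : ℕ) • f (contract i.castSucc a)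

/-- The alternating sum over all contractions, in which the `i`-th one has weight `m - i`. -/
noncomputable def wbar {m : ℕ} (f : (Fin m → A) → V) (a : Fin (m + 1) → A) : V :=
  ∑ i : Fin m, (((m : ℂ) - i) * (-1 : ℂ) ^ (i : ℕ)) • f (contract i.castSucc a)

/-- The alternating sum over all pairs of contractions. -/
noncomputable def bibar {m : ℕ} (f : (Fin m → A) → V) (a : Fin (m + 2) → A) : V :=
  ∑ j : Fin (m + 1), ∑ i : Fin m,
    if (i : ℕ) < j then
      (-1 : ℂ) ^ ((i : ℕ) + j + 1) • f (contract i.castSucc (contract j.castSucc a)) else 0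

theorem bar_cons {m : ℕ} (f : (Fin (m + 1) → A) → V) (x y : A) (l : Fin m → A) :
    bar f (tcons x (tcons y l)) =
      f (tcons (x * y) l) - bar (fun l' => f (tcons x l')) (tcons y l) := by
  rw [bar, Fin.sum_univ_succ, bar, sub_eq_add_neg, ← Finset.sum_neg_distrib]
  congr 1
  · simp [contract_zero]
  · refine Finset.sum_congr rfl fun i _ => ?_
    rw [← Fin.succ_castSucc, contract_succ, Fin.val_succ, pow_succ]
    simp

theorem bar_snoc {m : ℕ} (f : (Fin (m + 1) → A) → V) (l : Fin m → A) (y z : A) :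
    bar f (tsnoc (tsnoc l y) z) =
      bar (fun l' => f (tsnoc l' z)) (tsnoc l y) + (-1 : ℂ) ^ m • f (tsnoc l (y * z)) := by
  rw [bar, Fin.sum_univ_castSucc, bar]
  congr 1
  · refine Finset.sum_congr rfl fun i _ => ?_
    rw [contract_castSucc_tsnoc]
    simp
  · rw [contract_last_tsnoc]; simp

theorem wbar_cons {m : ℕ} (f : (Fin (m + 1) → A) → V) (x y : A) (l : Fin m → A) :
    wbar f (tcons x (tcons y l)) =
      ((m : ℂ) + 1) • f (tcons (x * y) l) - wbar (fun l' => f (tcons x l')) (tcons y l) := by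
  rw [wbar, Fin.sum_univ_succ, wbar, sub_eq_add_neg (_ • _), ← Finset.sum_neg_distrib]
  congr 1
  · simp [contract_zero]
  · refine Finset.sum_congr rfl fun i _ => ?_
    rw [← Fin.succ_castSucc, contract_succ, Fin.val_succ, pow_succ, ← neg_smul]
    congr 1
    push_cast
    ring

/-- A further entry raises every old weight by one and adds a last contraction of weight one; the
total surplus is `bar f`. -/
theorem wbar_snoc {m : ℕ} (f : (Fin (m + 1) → A) → V) (l : Fin m → A) (y z : A) :
    wbar f (tsnoc (tsnoc l y) z) =
      wbar (fun l' => f (tsnoc l' z)) (tsnoc l y) + bar f (tsnoc (tsnoc l y) z) := by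
  rw [bar_snoc, ← add_assoc, wbar, Fin.sum_univ_castSucc, wbar, bar, ← Finset.sum_add_distrib]
  congr 1
  · refine Finset.sum_congr rfl fun i _ => ?_
    rw [contract_castSucc_tsnoc, ← add_smul]
    congr 1
    simp
    ring
  · rw [contract_last_tsnoc]; simp

theorem bibar_cons {m : ℕ} (f : (Fin (m + 1) → A) → V) (x y z : A) (l : Fin m → A) :
    bibar f (tcons x (tcons y (tcons z l))) =
      f (tcons (x * (y * z)) l) - bar (fun l' => f (tcons (x * y) l')) (tcons z l) +
        bibar (fun l' => f (tcons x l')) (tcons y (tcons z l)) := by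
  have h1 : ∀ j : Fin (m + 1), (∑ i : Fin (m + 1), if (i : ℕ) < j.succ then
      (-1 : ℂ) ^ ((i : ℕ) + j.succ + 1) • f (contract i.castSucc (contract j.succ.castSucc
        (tcons x (tcons y (tcons z l))))) else 0) =
      (-1 : ℂ) ^ (j : ℕ) • f (contract 0 (tcons x (contract j.castSucc (tcons y (tcons z l))))) +
      ∑ i : Fin m, if (i : ℕ) < j then
        (-1 : ℂ) ^ ((i : ℕ) + j + 1) •
          f (tcons x (contract i.castSucc (contract j.castSucc (tcons y (tcons z l))))) else 0 := by
    intro j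
    rw [Fin.sum_univ_succ, ← Fin.succ_castSucc, contract_succ]
    congr 1
    · simp [pow_succ]
    · refine Finset.sum_congr rfl fun i _ => ?_
      rw [← Fin.succ_castSucc, contract_succ]
      simp only [Fin.val_succ, add_lt_add_iff_right]
      congr 2
      ring
  have h2 : ∑ j : Fin (m + 1), (-1 : ℂ) ^ (j : ℕ) •
      f (contract 0 (tcons x (contract j.castSucc (tcons y (tcons z l))))) =
      f (tcons (x * (y * z)) l) - bar (fun l' => f (tcons (x * y) l')) (tcons z l) := by
    rw [Fin.sum_univ_succ, bar, sub_eq_add_neg, ← Finset.sum_neg_distrib]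
    congr 1
    · simp [contract_zero]
    · refine Finset.sum_congr rfl fun i _ => ?_
      rw [← Fin.succ_castSucc, contract_succ, contract_zero, Fin.val_succ, pow_succ]
      simp
  rw [bibar, Fin.sum_univ_succ, Finset.sum_congr rfl fun j _ => h1 j, Finset.sum_add_distrib, h2]
  simp [bibar]

end Bar

end Contract

/-! ### Identities between the alternating sums. -/

section Identities

variable {A : Type*} [NonUnitalRing A] {V : Type*} [AddCommGroup V] [Module ℂ V]

theorem bar_add {m : ℕ} (f g : (Fin m → A) → V) : bar (f + g) = bar f + bar g := by
  funext a; simp [bar, Finset.sum_add_distrib]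

theorem bar_smul {m : ℕ} (c : ℂ) (f : (Fin m → A) → V) : bar (c • f) = c • bar f := by
  funext a
  simp only [bar, Pi.smul_apply, Finset.smul_sum]
  exact Finset.sum_congr rfl fun i _ => smul_comm _ _ _

theorem wbar_smul {m : ℕ} (c : ℂ) (f : (Fin m → A) → V) : wbar (c • f) = c • wbar f := by
  funext a
  simp only [wbar, Pi.smul_apply, Finset.smul_sum]
  exact Finset.sum_congr rfl fun i _ => smul_comm _ _ _

theorem bar_sub' {m : ℕ} (f g : (Fin m → A) → V) (a) :
    bar (fun l => f l - g l) a = bar f a - bar g a := by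
  simp [bar, Finset.sum_sub_distrib, smul_sub]

theorem wbar_sub' {m : ℕ} (f g : (Fin m → A) → V) (a) :
    wbar (fun l => f l - g l) a = wbar f a - wbar g a := by
  simp [wbar, Finset.sum_sub_distrib, smul_sub]

theorem bar_smul' {m : ℕ} (c : ℂ) (f : (Fin m → A) → V) (a) :
    bar (fun l => c • f l) a = c • bar f a :=
  congrFun (bar_smul c f) a

theorem wbar_smul' {m : ℕ} (c : ℂ) (f : (Fin m → A) → V) (a) :
    wbar (fun l => c • f l) a = c • wbar f a :=
  congrFun (wbar_smul c f) a

/-- `bar f` on `(x, l)`, as a function of `l`, when `l` is not empty. -/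
theorem bar_cons_fun {m : ℕ} (f : (Fin (m + 1) → A) → V) (x : A) (a : Fin (m + 1) → A) :
    bar f (tcons x a) =
      f (tcons (x * a 0) (Fin.tail a)) - bar (fun l' => f (tcons x l')) a := by
  rw [← tcons_head_tail a, bar_cons]; rfl

theorem bar_mul_left {m : ℕ} (f : (Fin (m + 1) → A) → V) (x y z : A) (l : Fin m → A) :
    bar (fun l : Fin (m + 1) → A => f (tcons (x * l 0) (Fin.tail l))) (tcons y (tcons z l)) =
      f (tcons (x * (y * z)) l) - bar (fun l => f (tcons (x * y) l)) (tcons z l) := by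
  rw [bar_cons]; rfl

theorem wbar_mul_left {m : ℕ} (f : (Fin (m + 1) → A) → V) (x y z : A) (l : Fin m → A) :
    wbar (fun l : Fin (m + 1) → A => f (tcons (x * l 0) (Fin.tail l))) (tcons y (tcons z l)) =
      ((m : ℂ) + 1) • f (tcons (x * (y * z)) l) -
        wbar (fun l => f (tcons (x * y) l)) (tcons z l) := by
  rw [wbar_cons]; rfl

theorem bar_bar {m : ℕ} (f : (Fin m → A) → V) : bar (bar f) = 0 := by
  funext a
  induction m with
  | zero => simp [bar]
  | succ m ih =>
    obtain ⟨x, a, rfl⟩ := exists_tcons a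
    obtain ⟨y, a, rfl⟩ := exists_tcons a
    obtain ⟨z, l, rfl⟩ := exists_tcons a
    rw [bar_cons, bar_cons, funext (bar_cons_fun f x), bar_sub', ih, bar_mul_left]
    simp [mul_assoc]

/-- On the right each double contraction occurs twice, once for each order. The two occurrences have
opposite signs and total weights that differ by one, so one signed copy remains. The formal proof
peels off leading entries. -/
theorem bibar_eq {m : ℕ} (f : (Fin m → A) → V) : bibar f = bar (wbar f) + wbar (bar f) := by
  funext a
  rw [Pi.add_apply]
  induction m with
  | zero => simp [bar, wbar, bibar]
  | succ m ih =>
    obtain ⟨x, a, rfl⟩ := exists_tcons a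
    obtain ⟨y, a, rfl⟩ := exists_tcons a
    obtain ⟨z, l, rfl⟩ := exists_tcons a
    have e : ∀ a : Fin (m + 1) → A, wbar f (tcons x a) = ((m : ℂ) + 1) •
        f (tcons (x * a 0) (Fin.tail a)) - wbar (fun l' => f (tcons x l')) a := by
      intro a
      rw [← tcons_head_tail a, wbar_cons]; rfl
    rw [bibar_cons, bar_cons (wbar f), wbar_cons, wbar_cons, bar_cons f, ih, funext e,
      funext (bar_cons_fun f x), bar_sub', wbar_sub', bar_smul', bar_mul_left, wbar_mul_left]
    simp only [mul_assoc]
    push_cast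
    module

/-! ### Twisted cyclic cochains -/

variable (σ : A → A)

/-- The rotation with the sign `(-1)^n`: `f(a_0, …, a_n) ↦ (-1)^n f(σ a_n, a_0, …, a_{n-1})`. -/
noncomputable def lam {n : ℕ} (f : (Fin (n + 1) → A) → ℂ) (a : Fin (n + 1) → A) : ℂ :=
  (-1) ^ n * f (tcons (σ (a (Fin.last n))) (Fin.init a))

/-- The opposite rotation: `f(a_0, …, a_n) ↦ (-1)^n f(a_1, …, a_n, σ a_0)`. -/
noncomputable def mu {n : ℕ} (f : (Fin (n + 1) → A) → ℂ) (a : Fin (n + 1) → A) : ℂ :=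
  (-1) ^ n * f (tsnoc (Fin.tail a) (σ (a 0)))

/-- The twisted Hochschild coboundary. -/
noncomputable def tb {n : ℕ} (f : (Fin (n + 1) → A) → ℂ) (a : Fin (n + 2) → A) : ℂ :=
  bar f a + (-1) ^ (n + 1) * f (contract 0 (tcons (σ (a (Fin.last (n + 1)))) (Fin.init a)))

variable {σ}

omit [NonUnitalRing A] in
theorem lam_snoc {n : ℕ} (f : (Fin (n + 1) → A) → ℂ) (l : Fin n → A) (z : A) :
    lam σ f (tsnoc l z) = (-1) ^ n * f (tcons (σ z) l) := by
  simp [lam]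

theorem tb_snoc {n : ℕ} (f : (Fin (n + 1) → A) → ℂ) (x : A) (l : Fin n → A) (z : A) :
    tb σ f (tsnoc (tcons x l) z) =
      bar f (tsnoc (tcons x l) z) + (-1) ^ (n + 1) * f (tcons (σ z * x) l) := by
  rw [tb, ← contract_zero]
  simp

theorem lam_mu (h2 : ∀ x, σ (σ x) = x) {n : ℕ} (f : (Fin (n + 1) → A) → ℂ) :
    lam σ (mu σ f) = f := by
  funext a
  obtain ⟨l, z, rfl⟩ := exists_tsnoc a
  rw [lam_snoc, mu]
  simp only [Fin.tail_cons, Fin.cons_zero, h2, ← mul_assoc, ← mul_pow]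
  simp

omit [NonUnitalRing A] in
theorem lam_add {n : ℕ} (f g : (Fin (n + 1) → A) → ℂ) : lam σ (f + g) = lam σ f + lam σ g := by
  funext a; simp [lam, mul_add]

omit [NonUnitalRing A] in
theorem lam_smul {n : ℕ} (c : ℂ) (f : (Fin (n + 1) → A) → ℂ) : lam σ (c • f) = c • lam σ f := by
  funext a; simp [lam, mul_left_comm]

omit [NonUnitalRing A] in
theorem lam_sub {n : ℕ} (f g : (Fin (n + 1) → A) → ℂ) : lam σ (f - g) = lam σ f - lam σ g := by
  funext a; simp [lam, mul_sub]

omit [NonUnitalRing A] in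
theorem lam_sum {n : ℕ} {ι : Type*} (s : Finset ι) (f : ι → (Fin (n + 1) → A) → ℂ) :
    lam σ (∑ i ∈ s, f i) = ∑ i ∈ s, lam σ (f i) := by
  funext a; simp [lam, Finset.mul_sum]

theorem bar_sub {m : ℕ} (f g : (Fin m → A) → V) : bar (f - g) = bar f - bar g := by
  funext a; exact bar_sub' f g a

theorem tb_add {n : ℕ} (f g : (Fin (n + 1) → A) → ℂ) : tb σ (f + g) = tb σ f + tb σ g := by
  funext a; simp [tb, bar_add, mul_add]; ring

theorem tb_smul {n : ℕ} (c : ℂ) (f : (Fin (n + 1) → A) → ℂ) : tb σ (c • f) = c • tb σ f := by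
  funext a; simp [tb, bar_smul]; ring

theorem tb_sub {n : ℕ} (f g : (Fin (n + 1) → A) → ℂ) : tb σ (f - g) = tb σ f - tb σ g := by
  funext a; simp [tb, bar_sub]; ring

theorem neg_one_mul_self (n : ℕ) (x : ℂ) : (-1) ^ n * ((-1) ^ n * x) = x := by
  rw [← mul_assoc, ← mul_pow]; simp

theorem neg_one_sq_pow (n : ℕ) : ((-1 : ℂ) ^ n) ^ 2 = 1 := by
  rw [← pow_mul, mul_comm, pow_mul]; simp

variable (hσ : ∀ x y, σ (x * y) = σ x * σ y)
include hσ

/-- This is the relation (1 - λ) b = b'(1 - λ). Rotation permutes the contractions up to wrap-around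
terms, and those match because σ is multiplicative. -/
theorem tb_sub_lam_tb {n : ℕ} (f : (Fin (n + 1) → A) → ℂ) :
    tb σ f - lam σ (tb σ f) = bar (f - lam σ f) := by
  rw [bar_sub]
  funext a
  obtain ⟨l, z, rfl⟩ := exists_tsnoc a
  have h : bar (lam σ f) (tsnoc l z) = (-1) ^ n * bar (fun l' => f (tcons (σ z) l')) l +
      f (tcons (σ (l (Fin.last n) * z)) (Fin.init l)) := by
    obtain ⟨l, y, rfl⟩ := exists_tsnoc l
    have e : (fun l' => lam σ f (tsnoc l' z)) = fun l' => (-1 : ℂ) ^ n • f (tcons (σ z) l') :=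
      funext fun l' => lam_snoc f l' z
    rw [bar_snoc, lam_snoc, e, bar_smul', smul_eq_mul, smul_eq_mul, neg_one_mul_self]
    simp
  simp only [Pi.sub_apply, h, lam_snoc]
  have h1 : tb σ f (tsnoc l z) = bar f (tsnoc l z) +
      (-1) ^ (n + 1) * f (tcons (σ z * l 0) (Fin.tail l)) := by
    obtain ⟨x, l, rfl⟩ := exists_tcons l
    exact tb_snoc f x l z
  have h2 : tb σ f (tcons (σ z) l) = bar f (tcons (σ z) l) +
      (-1) ^ (n + 1) * f (tcons (σ (l (Fin.last n) * z)) (Fin.init l)) := by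
    obtain ⟨l, y, rfl⟩ := exists_tsnoc l
    rw [tcons_tsnoc, tb_snoc, init_tsnoc, tsnoc_last, hσ]
  rw [h1, h2, bar_cons_fun]
  have := neg_one_sq_pow n
  linear_combination (-f (tcons (σ (l (Fin.last n) * z)) (Fin.init l))) * this

theorem tb_tb {n : ℕ} (f : (Fin (n + 1) → A) → ℂ) : tb σ (tb σ f) = 0 := by
  funext a
  obtain ⟨a, z, rfl⟩ := exists_tsnoc a
  obtain ⟨x, l, rfl⟩ := exists_tcons a
  have e : ∀ a : Fin (n + 2) → A, tb σ f a = bar f a + (-1 : ℂ) ^ (n + 1) •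
      f (tcons (σ (a (Fin.last _)) * a 0) (Fin.tail (Fin.init a))) := by
    intro a
    obtain ⟨a, z, rfl⟩ := exists_tsnoc a
    obtain ⟨x, l, rfl⟩ := exists_tcons a
    have e0 : tsnoc (tcons x l) z 0 = x := by rw [← tcons_tsnoc]; rfl
    rw [tb_snoc, e0]
    simp
  have e' : tb σ f = bar f + (-1 : ℂ) ^ (n + 1) • fun a : Fin (n + 2) → A =>
      f (tcons (σ (a (Fin.last _)) * a 0) (Fin.tail (Fin.init a))) := funext e
  rw [tb_snoc]
  have h2 : tb σ f (tcons (σ z * x) l) = bar f (tcons (σ z * x) l) +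
      (-1) ^ (n + 1) * f (tcons (σ (l (Fin.last n) * z) * x) (Fin.init l)) := by
    obtain ⟨l, y, rfl⟩ := exists_tsnoc l
    rw [tcons_tsnoc, tb_snoc, init_tsnoc, tsnoc_last, hσ, mul_assoc]
  rw [h2, e', bar_add, bar_smul, bar_bar, zero_add, Pi.smul_apply, ← tcons_tsnoc, bar_cons_fun,
    bar_cons_fun]
  have h3 : bar (fun l' : Fin (n + 1) → A => f (tcons
      (σ (tcons x l' (Fin.last (n + 1))) * tcons x l' 0)
        (Fin.tail (Fin.init (tcons x l'))))) (tsnoc l z) =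
      bar (fun l' => f (tcons (σ z * x) l')) l +
        (-1) ^ n * f (tcons (σ (l (Fin.last n) * z) * x) (Fin.init l)) := by
    obtain ⟨l, y, rfl⟩ := exists_tsnoc l
    rw [bar_snoc]
    simp only [tcons_tsnoc, Fin.snoc_last, Fin.init_snoc, Fin.tail_cons]
    simp only [← tcons_tsnoc, Fin.cons_zero, smul_eq_mul]
  rw [h3]
  have h4 : f (tcons (σ (tcons (x * tsnoc l z 0) (Fin.tail (tsnoc l z))
      (Fin.last (n + 1))) * tcons (x * tsnoc l z 0) (Fin.tail (tsnoc l z)) 0)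
      (Fin.tail (Fin.init (tcons (x * tsnoc l z 0) (Fin.tail (tsnoc l z)))))) =
      f (tcons (σ z * x * l 0) (Fin.tail l)) := by
    obtain ⟨y, l, rfl⟩ := exists_tcons l
    rw [← tcons_tsnoc, tail_tcons, tcons_zero, tcons_zero, tcons_tsnoc, tsnoc_last, init_tsnoc,
      tail_tcons, tail_tcons, tcons_zero, mul_assoc]
  rw [h4]
  simp only [smul_eq_mul, Pi.zero_apply]
  ring

omit hσ

/-- For such g, the rotation of b g is exactly the wrap-around term of b g, so subtracting it leaves
the inner contractions. This exhibits b' g in the image of 1 - λ. -/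
theorem sub_lam_of_tb_eq {n : ℕ} {g : (Fin (n + 1) → A) → ℂ}
    (hg : ∀ a, tb σ g a = g (contract 0 a)) : bar g = tb σ g - lam σ (tb σ g) := by
  funext a
  have h : lam σ (tb σ g) a = (-1) ^ (n + 1) *
      g (contract 0 (tcons (σ (a (Fin.last (n + 1)))) (Fin.init a))) := by
    rw [lam, hg]
  rw [Pi.sub_apply, h, tb]
  ring

theorem bar_snoc_of_tb_eq_zero {n : ℕ} {f : (Fin (n + 1) → A) → ℂ} (hb : tb σ f = 0)
    (a : Fin (n + 1) → A) (z : A) :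
    bar f (tsnoc a z) = (-1 : ℂ) ^ n • f (tcons (σ z * a 0) (Fin.tail a)) := by
  obtain ⟨x, l, rfl⟩ := exists_tcons a
  have h := congrFun hb (tsnoc (tcons x l) z)
  rw [tb_snoc, Pi.zero_apply] at h
  simp only [tcons_zero, tail_tcons, smul_eq_mul]
  linear_combination h

/-- Compared with `bibar_eq`, only `wbar (bar f)` has to be recognised as the wrap-around term.
Since `bar (bar f) = 0`, the weights may be shifted so that the last entry takes no part; the
cocycle condition then moves that entry to the front. -/
theorem bibar_eq_tb_wbar {n : ℕ} {f : (Fin (n + 1) → A) → ℂ} (hb : tb σ f = 0) :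
    bibar f = tb σ (wbar f) := by
  funext a
  obtain ⟨a, z, rfl⟩ := exists_tsnoc a
  obtain ⟨x, l, rfl⟩ := exists_tcons a
  rw [bibar_eq, Pi.add_apply, tb_snoc]
  congr 1
  have h : wbar (bar f) (tsnoc (tcons x l) z) =
      wbar (fun a => bar f (tsnoc a z)) (tcons x l) := by
    obtain ⟨l, y, rfl⟩ := exists_tsnoc l
    rw [tcons_tsnoc, wbar_snoc, bar_bar, Pi.zero_apply, add_zero]
  obtain ⟨y, l, rfl⟩ := exists_tcons l
  rw [h, funext fun a => bar_snoc_of_tb_eq_zero hb a z, wbar_smul', wbar_mul_left, wbar_cons,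
    smul_eq_mul, mul_assoc (σ z), pow_succ, pow_succ]
  ring

/-- Rotation shifts all weights by one, which leaves one copy of `bar f`. The contraction that
becomes the first one has weight n + 1, and the cocycle condition turns it into n + 1 further
copies. -/
theorem wbar_sub_lam {n : ℕ} {f : (Fin (n + 1) → A) → ℂ} (hl : lam σ f = f) (hb : tb σ f = 0) :
    wbar f - lam σ (wbar f) = ((n : ℂ) + 2) • bar f := by
  funext a
  obtain ⟨l, z, rfl⟩ := exists_tsnoc a
  have e : (fun l' => f (tcons (σ z) l')) = fun l' => (-1 : ℂ) ^ n • f (tsnoc l' z) := by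
    funext l'
    have h := congrFun hl (tsnoc l' z)
    rw [lam_snoc] at h
    rw [← h, smul_eq_mul, neg_one_mul_self]
  have h1 : wbar f (tcons (σ z) l) = ((n : ℂ) + 1) • f (tcons (σ z * l 0) (Fin.tail l)) -
      wbar (fun l' => f (tcons (σ z) l')) l := by
    obtain ⟨y, l, rfl⟩ := exists_tcons l
    exact wbar_cons f (σ z) y l
  have h2 : wbar f (tsnoc l z) = wbar (fun l' => f (tsnoc l' z)) l + bar f (tsnoc l z) := by
    obtain ⟨l, y, rfl⟩ := exists_tsnoc l
    exact wbar_snoc f l y z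
  have h3 := bar_snoc_of_tb_eq_zero hb l z
  rw [Pi.sub_apply, lam_snoc, h1, h2, e, wbar_smul', Pi.smul_apply]
  simp only [smul_eq_mul] at h3 ⊢
  have := neg_one_sq_pow n
  rw [h3]
  linear_combination (-wbar (fun l' => f (tsnoc l' z)) l) * this

include hσ

/-- (1 - λ) b w f = b'(1 - λ) w f = (n + 2) b' b' f = 0. -/
theorem lam_bibar {n : ℕ} {f : (Fin (n + 1) → A) → ℂ} (hl : lam σ f = f) (hb : tb σ f = 0) :
    lam σ (bibar f) = bibar f := by
  have h := tb_sub_lam_tb hσ (wbar f)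
  rw [wbar_sub_lam hl hb, bar_smul, bar_bar, smul_zero, ← bibar_eq_tb_wbar hb, sub_eq_zero] at h
  exact h.symm

theorem tb_bibar {n : ℕ} {f : (Fin (n + 1) → A) → ℂ} (hb : tb σ f = 0) :
    tb σ (bibar f) = 0 := by
  rw [bibar_eq_tb_wbar hb, tb_tb hσ]

/-- If a cyclic cocycle is the sum of all rotations of a cochain `g` whose coboundary is
`g(a_0 a_1, …)`, then its image under the periodicity operator is the coboundary of a cyclic
cochain. -/
theorem bibar_eq_tb_cyclic (h2 : ∀ x, σ (σ x) = x) {n : ℕ} {f g : (Fin (n + 1) → A) → ℂ}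
    (hl : lam σ f = f) (hb : tb σ f = 0) (hg : ∀ a, tb σ g a = g (contract 0 a))
    (hs : f = ∑ j ∈ Finset.range (n + 1), (mu σ)^[j] g) (θ : (Fin (n + 2) → A) → ℂ)
    (hθ : θ = wbar f - ((n : ℂ) + 2) • (((n : ℂ) + 1) • tb σ g + tb σ
      (∑ j ∈ Finset.range (n + 1), ∑ i ∈ Finset.range j, (mu σ)^[i + 1] g))) :
    lam σ θ = θ ∧ bibar f = tb σ θ := by
  -- Since λ undoes μ, the partial sums of rotations telescope under 1 - λ, which makes k a solution
  -- of (1 - λ) k = f - (n + 1) g.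
  set k := ∑ j ∈ Finset.range (n + 1), ∑ i ∈ Finset.range j, (mu σ)^[i + 1] g with hk
  have hkl : k - lam σ k = f - ((n : ℂ) + 1) • g := by
    rw [hk, lam_sum, ← Finset.sum_sub_distrib, hs]
    have : ∀ j, (∑ i ∈ Finset.range j, (mu σ)^[i + 1] g) -
        lam σ (∑ i ∈ Finset.range j, (mu σ)^[i + 1] g) = (mu σ)^[j] g - g := by
      intro j
      rw [lam_sum, ← Finset.sum_sub_distrib]
      simp only [Function.iterate_succ_apply', lam_mu h2]
      simp only [← Function.iterate_succ_apply' (mu σ)]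
      rw [Finset.sum_range_sub (fun i => (mu σ)^[i] g)]
      rfl
    rw [Finset.sum_congr rfl fun j _ => this j, Finset.sum_sub_distrib]
    rw [Finset.sum_const, Finset.card_range, ← Nat.cast_smul_eq_nsmul ℂ, Nat.cast_succ]
  -- After the rewriting, (1 - λ) b k = b' f - (n + 1)(1 - λ) b g: the obstruction b' f is 1 - λ of
  -- a coboundary.
  have h1 := tb_sub_lam_tb hσ k
  rw [hkl, bar_sub, bar_smul, sub_lam_of_tb_eq hg] at h1
  refine ⟨?_, ?_⟩
  · have h3 := wbar_sub_lam hl hb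
    rw [hθ, lam_sub, lam_smul, lam_add, lam_smul, ← sub_eq_zero]
    rw [← sub_eq_zero] at h1 h3
    linear_combination (norm := module) (-1 : ℂ) • h3 + ((n : ℂ) + 2) • h1
  · rw [hθ, tb_sub, tb_smul, tb_add, tb_smul, tb_tb hσ, tb_tb hσ, bibar_eq_tb_wbar hb]
    simp

end Identities

end TwistedCyclic

/-! ### The forms `a_0 da_1 ⋯ da_n` as products of operators -/

namespace NCChain

open TwistedCyclic

variable {Ω : Type*} [NonUnitalRing Ω] [Module ℂ Ω] [IsScalarTower ℂ Ω Ω] [SMulCommClass ℂ Ω Ω]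
  [TopologicalSpace Ω] [SuperAlgebra Ω] {𝓕 : SuperFiltration Ω} (C : NCChain 𝓕)

/-- Right multiplication by `da`, up to parity, on the elements `p + q X` of `Ω~`. -/
def step (a : Ω) : Module.End ℂ (Ω × Ω) where
  toFun v := (parity v.1 * C.nabla a + v.2 * a, -C.curvR (v.1 * a))
  map_add' v w := by
    simp only [Prod.fst_add, Prod.snd_add, map_add, add_mul, neg_add, Prod.mk_add_mk]
    congr 1
    abel
  map_smul' c v := by
    simp [smul_mul_assoc]

theorem step_apply (a : Ω) (v : Ω × Ω) :
    C.step a v = (parity v.1 * C.nabla a + v.2 * a, -C.curvR (v.1 * a)) := rfl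

/-- The operator `(p, q) ↦ (p a, 0)`. -/
def cut (a : Ω) : Module.End ℂ (Ω × Ω) where
  toFun v := (v.1 * a, 0)
  map_add' v w := by simp [add_mul]
  map_smul' c v := by simp [smul_mul_assoc]

theorem cut_apply (a : Ω) (v : Ω × Ω) : cut a v = (v.1 * a, 0) := rfl

/-- The operator that anticommutes with all the operators `step a`. -/
def conn : Module.End ℂ (Ω × Ω) where
  toFun v := (-C.nabla v.1 + v.2, C.curvR v.1 + C.nabla v.2)
  map_add' v w := by
    simp only [Prod.fst_add, Prod.snd_add, map_add, neg_add, Prod.mk_add_mk]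
    congr 1 <;> abel
  map_smul' c v := by simp

theorem conn_apply (v : Ω × Ω) :
    C.conn v = (-C.nabla v.1 + v.2, C.curvR v.1 + C.nabla v.2) := rfl

/-- The operator `(p, q) ↦ (0, p^ η)`, where `p^` is the image of `p` under the parity
automorphism. -/
def slot (η : Ω) : Module.End ℂ (Ω × Ω) where
  toFun v := (0, parity v.1 * η)
  map_add' v w := by simp [add_mul]
  map_smul' c v := by simp [smul_mul_assoc]

theorem slot_apply (η : Ω) (v : Ω × Ω) : slot η v = (0, parity v.1 * η) := rfl

/-- The derivative of `step a` along the variation `ad_η` of the connection. -/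
def dstep (η a : Ω) : Module.End ℂ (Ω × Ω) where
  toFun v := (parity v.1 * (η * a - parity a * η), -(v.1 * a * C.nabla η))
  map_add' v w := by
    simp only [Prod.fst_add, map_add, add_mul, neg_add, Prod.mk_add_mk]
  map_smul' c v := by simp [smul_mul_assoc]

theorem dstep_apply (η a : Ω) (v : Ω × Ω) : C.dstep η a v =
    (parity v.1 * (η * a - parity a * η), -(v.1 * a * C.nabla η)) := rfl

/-- This is d(xy) = (dx) y + x dy for right multiplications. Right multiplication by an element of Ω
is `cut`, which drops the second coordinate because (aX)b = 0. -/
theorem step_mul (x y : Ω) : C.step (x * y) = cut y * C.step x + C.step y * cut x := by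
  refine LinearMap.ext fun v => ?_
  simp only [LinearMap.add_apply, Module.End.mul_apply, step_apply, cut_apply, Prod.mk_add_mk,
    C.nabla_mul_parity, parity_mul, mul_add, add_mul, mul_assoc]
  simp
  abel

theorem curvR_mul_right (x a : Ω) : C.curvR x * a = x * C.curvL a := (C.mul_curvL x a).symm

/-- The terms with ∇²a = ωa - aω are compensated by the curvature in the second coordinates. The
relation lets ∇ pass all differentials although ∇² is not zero. -/
theorem conn_mul_step (a : Ω) : C.conn * C.step a = -(C.step a * C.conn) := by
  refine LinearMap.ext fun v => ?_
  simp only [LinearMap.neg_apply, Module.End.mul_apply, step_apply, conn_apply, map_add, map_neg,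
    C.nabla_mul_parity, C.nabla_parity, parity_parity, C.nabla_nabla, mul_add, add_mul, mul_assoc,
    C.curvR_mul, C.nabla_curvR, C.curvR_mul_right, neg_mul, mul_sub, Prod.neg_mk]
  congr 1 <;> abel

/-- The variation is split into two commutators with different roles: the one with `slot η`
telescopes along a product of steps, while the one with `conn` can be carried to the ends, where the
trace controls it. -/
theorem dstep_eq {η : Ω} (ho : parity η = -η) (a : Ω) : C.dstep η a =
    C.step a * slot η - slot η * C.step a + (slot η * cut a * C.conn - C.conn * (slot η * cut a)) := by
  have h2 : parity (C.nabla η) = C.nabla η := by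
    have := C.nabla_parity η
    rw [ho, map_neg, neg_inj] at this
    exact this.symm
  refine LinearMap.ext fun v => ?_
  simp only [LinearMap.sub_apply, LinearMap.add_apply, Module.End.mul_apply, step_apply, conn_apply,
    map_add, map_neg, slot_apply, cut_apply, dstep_apply, parity_mul, ho,
    C.nabla_mul_parity, C.nabla_parity, parity_parity, C.nabla_nabla, mul_add, add_mul, mul_assoc,
    C.curvR_mul, C.nabla_curvR, C.curvR_mul_right, neg_mul, mul_sub, Prod.neg_mk, map_zero,
    zero_mul, mul_zero, mul_neg, zero_add, neg_zero, Prod.mk_add_mk, Prod.mk_sub_mk]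
  congr 1 <;> abel

/-- The product of the operators `step b_i, …, step b_{i + k - 1}`. -/
def seg (b : ℕ → Ω) : ℕ → ℕ → Module.End ℂ (Ω × Ω)
  | _, 0 => 1
  | i, k + 1 => seg b (i + 1) k * C.step (b i)

/-- The derivative of `seg` along the variation `ad_η` of the connection. -/
def dseg (η : Ω) (b : ℕ → Ω) : ℕ → ℕ → Module.End ℂ (Ω × Ω)
  | _, 0 => 0
  | i, k + 1 => dseg η b (i + 1) k * C.step (b i) + C.seg b (i + 1) k * C.dstep η (b i)

theorem seg_add (b : ℕ → Ω) : ∀ k l i, C.seg b i (k + l) = C.seg b (i + k) l * C.seg b i k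
  | 0, l, i => by simp [seg]
  | k + 1, l, i => by
    rw [add_right_comm, seg, seg_add b k l (i + 1), seg, mul_assoc]
    congr 2
    ring

theorem seg_succ (b : ℕ → Ω) (i k : ℕ) : C.seg b i (k + 1) = C.step (b (i + k)) * C.seg b i k := by
  rw [seg_add]; simp [seg]

theorem end_mul_neg (f g : Module.End ℂ (Ω × Ω)) : f * -g = -(f * g) :=
  LinearMap.ext fun v => by simp [Module.End.mul_apply]

theorem conn_mul_seg (b : ℕ → Ω) : ∀ k i, C.conn * C.seg b i k = (-1 : ℂ) ^ k • (C.seg b i k * C.conn)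
  | 0, i => by simp [seg]
  | k + 1, i => by
    rw [seg, ← mul_assoc, conn_mul_seg b k, smul_mul_assoc, mul_assoc, conn_mul_step, pow_succ,
      end_mul_neg, mul_assoc]
    module

/-- The commutators with `slot η` telescope. In the j-th other term `conn` is moved outwards past
the remaining k - 1 steps; each passage changes the sign, which explains (-1)^j and (-1)^k. -/
theorem dseg_eq {η : Ω} (ho : parity η = -η) (b : ℕ → Ω) : ∀ k i, C.dseg η b i k =
    C.seg b i k * slot η - slot η * C.seg b i k + ∑ j ∈ Finset.range k, (-1 : ℂ) ^ j •
      (C.seg b (i + j + 1) (k - 1 - j) * (slot η * cut (b (i + j))) * C.seg b i j * C.conn +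
      (-1 : ℂ) ^ k • (C.conn *
        (C.seg b (i + j + 1) (k - 1 - j) * (slot η * cut (b (i + j))) * C.seg b i j)))
  | 0, i => by simp [dseg, seg]
  | k + 1, i => by
    rw [dseg, dseg_eq ho b k (i + 1), C.dstep_eq ho, Finset.sum_range_succ']
    have h : ∀ j ∈ Finset.range k, (-1 : ℂ) ^ (j + 1) •
      (C.seg b (i + (j + 1) + 1) (k + 1 - 1 - (j + 1)) * (slot η * cut (b (i + (j + 1)))) *
        C.seg b i (j + 1) * C.conn + (-1 : ℂ) ^ (k + 1) • (C.conn *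
        (C.seg b (i + (j + 1) + 1) (k + 1 - 1 - (j + 1)) * (slot η * cut (b (i + (j + 1)))) *
          C.seg b i (j + 1)))) =
      (-1 : ℂ) ^ j • (C.seg b (i + 1 + j + 1) (k - 1 - j) * (slot η * cut (b (i + 1 + j))) *
        C.seg b (i + 1) j * C.conn + (-1 : ℂ) ^ k • (C.conn *
        (C.seg b (i + 1 + j + 1) (k - 1 - j) * (slot η * cut (b (i + 1 + j))) *
          C.seg b (i + 1) j))) * C.step (b i) := by
      intro j hj
      have e1 : i + (j + 1) = i + 1 + j := by omega
      have e2 : k + 1 - 1 - (j + 1) = k - 1 - j := by omega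
      have e3 := C.conn_mul_step (b i)
      rw [e1, e2, seg, smul_mul_assoc, add_mul, smul_mul_assoc, mul_assoc _ C.conn (C.step (b i)),
        e3, pow_succ, pow_succ]
      simp only [mul_assoc, end_mul_neg]
      module
    rw [Finset.sum_congr rfl h, ← Finset.sum_mul]
    have h2 := C.conn_mul_seg b k (i + 1)
    have h3 : C.seg b (i + 1) k * C.conn = (-1 : ℂ) ^ k • (C.conn * C.seg b (i + 1) k) := by
      rw [h2, smul_smul, ← mul_pow]; simp
    simp only [add_zero, Nat.add_sub_cancel, Nat.sub_zero, pow_zero, one_smul, seg, mul_one,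
      pow_succ, ← mul_assoc, mul_add, mul_sub, add_mul, sub_mul, h3,
      smul_mul_assoc]
    module

end NCChain

/-! ### Coboundary and rotation of the functionals on Ω. -/

namespace NCChain

open TwistedCyclic

variable {Ω : Type*} [NonUnitalRing Ω] [Module ℂ Ω] [IsScalarTower ℂ Ω Ω] [SMulCommClass ℂ Ω Ω]
  [TopologicalSpace Ω] [SuperAlgebra Ω] {𝓕 : SuperFiltration Ω} (C : NCChain 𝓕)

/-- The product of the operators `step a_0, …, step a_{k - 1}`. -/
def steps : {k : ℕ} → (Fin k → Ω) → Module.End ℂ (Ω × Ω)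
  | 0, _ => 1
  | _ + 1, a => steps (Fin.tail a) * C.step (a 0)

theorem seg_eq_steps (b : ℕ → Ω) : ∀ k i, C.seg b i k = C.steps fun j : Fin k => b (i + j)
  | 0, _ => rfl
  | k + 1, i => by
    rw [seg, seg_eq_steps b k (i + 1), steps]
    congr 2
    funext j
    simp only [Fin.tail, Fin.val_succ]
    congr 1
    ring

theorem steps_tcons {k : ℕ} (x : Ω) (l : Fin k → Ω) :
    C.steps (tcons x l) = C.steps l * C.step x := rfl

theorem steps_tsnoc {k : ℕ} (l : Fin k → Ω) (z : Ω) :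
    C.steps (tsnoc l z) = C.step z * C.steps l := by
  induction k with
  | zero =>
    have : tsnoc l z = tcons z l := by
      funext i; rw [Fin.fin_one_eq_zero i]; rfl
    rw [this]
    simp [steps]
  | succ k ih =>
    obtain ⟨x, l, rfl⟩ := exists_tcons l
    rw [← tcons_tsnoc, steps_tcons, ih, steps_tcons, mul_assoc]

/-- By the Leibniz rule every contraction gives two terms, and neighbouring contractions cancel in
pairs; only the two ends survive. -/
theorem bar_steps {k : ℕ} (a : Fin (k + 1) → Ω) : bar C.steps a =
    C.steps (Fin.tail a) * cut (a 0) -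
      (-1 : ℂ) ^ k • (cut (a (Fin.last k)) * C.steps (Fin.init a)) := by
  induction k with
  | zero => simp [bar, steps]
  | succ k ih =>
    obtain ⟨x, l, rfl⟩ := exists_tcons a
    obtain ⟨y, l, rfl⟩ := exists_tcons l
    have h : bar (fun l' => C.steps (tcons x l')) (tcons y l) =
        bar C.steps (tcons y l) * C.step x := by
      simp only [bar, steps_tcons, Finset.sum_mul, smul_mul_assoc]
    rw [bar_cons, h, ih, steps_tcons, step_mul, init_tcons, steps_tcons, tail_tcons, tail_tcons,
      steps_tcons, pow_succ]
    have e : tcons x (tcons y l) (Fin.last (k + 1)) = tcons y l (Fin.last k) := rfl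
    simp only [e, tcons_zero, mul_add, sub_mul, mul_assoc, smul_mul_assoc]
    module

/-! #### Behaviour under left multiplication and parity -/

/-- Left multiplication of `p + q X` by `x`, with the sign rule for `X`. -/
def tact (x : Ω) (v : Ω × Ω) : Ω × Ω := (x * v.1, parity x * v.2)

theorem step_tact (a x : Ω) (v : Ω × Ω) :
    C.step a (tact x v) = tact (parity x) (C.step a v) := by
  simp [step_apply, tact, parity_mul, parity_parity, mul_assoc, mul_add, C.curvR_mul]

theorem steps_tact {k : ℕ} (a : Fin k → Ω) (x : Ω) (v : Ω × Ω) :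
    C.steps a (tact x v) = tact (parity^[k] x) (C.steps a v) := by
  induction k generalizing x v with
  | zero => rfl
  | succ k ih =>
    rw [steps, Module.End.mul_apply, step_tact, ih]
    rfl

theorem seg_tact (b : ℕ → Ω) (i k : ℕ) (x : Ω) (v : Ω × Ω) :
    C.seg b i k (tact x v) = tact (parity^[k] x) (C.seg b i k v) := by
  rw [seg_eq_steps, steps_tact]

theorem slot_tact (η x : Ω) (v : Ω × Ω) : slot η (tact x v) = tact x (slot η v) := by
  simp [slot_apply, tact, parity_mul, mul_assoc]

/-- The parity automorphism of `p + q X`. -/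
def flip : Module.End ℂ (Ω × Ω) where
  toFun v := (parity v.1, -parity v.2)
  map_add' v w := by
    simp only [Prod.fst_add, Prod.snd_add, map_add, neg_add, Prod.mk_add_mk]
  map_smul' c v := by simp

theorem flip_apply (v : Ω × Ω) : flip v = (parity v.1, -parity v.2) := rfl

theorem step_parity_flip (a : Ω) : C.step (parity a) * flip = -(flip * C.step a) := by
  refine LinearMap.ext fun v => ?_
  simp only [Module.End.mul_apply, LinearMap.neg_apply, flip_apply, step_apply, parity_parity,
    C.nabla_parity, map_add, map_neg, parity_mul, neg_mul, mul_neg, Prod.neg_mk]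
  congr 1
  · abel
  · rw [← parity_mul, C.curvR_parity, neg_neg]

theorem steps_parity_flip {k : ℕ} (a : Fin k → Ω) :
    C.steps (fun j => parity (a j)) * flip = (-1 : ℂ) ^ k • (flip * C.steps a) := by
  induction k with
  | zero => simp [steps]
  | succ k ih =>
    obtain ⟨x, l, rfl⟩ := exists_tcons a
    have e : (fun j => parity (tcons x l j)) = tcons (parity x) fun j => parity (l j) := by
      funext j
      exact Fin.cases rfl (fun _ => rfl) j
    rw [e, steps_tcons, mul_assoc, step_parity_flip, end_mul_neg, ← mul_assoc, ih, smul_mul_assoc,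
      steps_tcons, pow_succ, mul_assoc]
    module

theorem steps_iterate_parity_flip {k : ℕ} (s : ℕ) (a : Fin k → Ω) :
    C.steps (fun j => parity^[s] (a j)) * flip ^ s = (-1 : ℂ) ^ (k * s) • (flip ^ s * C.steps a) := by
  induction s with
  | zero => simp
  | succ s ih =>
    simp only [Function.iterate_succ_apply']
    rw [pow_succ' flip, ← mul_assoc, steps_parity_flip, smul_mul_assoc, mul_assoc flip, ih,
      Nat.mul_succ, pow_add, mul_comm ((-1 : ℂ) ^ (k * s)), mul_smul_comm, smul_smul, mul_assoc]

theorem fst_flip_pow (s : ℕ) (v : Ω × Ω) : ((flip ^ s) v).1 = parity^[s] v.1 := by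
  induction s with
  | zero => rfl
  | succ s ih => rw [pow_succ', Module.End.mul_apply, flip_apply, ih, Function.iterate_succ_apply']

theorem snd_flip_pow (s : ℕ) (v : Ω × Ω) :
    ((flip ^ s) v).2 = (-1 : ℂ) ^ s • parity^[s] v.2 := by
  induction s with
  | zero => simp
  | succ s ih =>
    rw [pow_succ', Module.End.mul_apply, flip_apply, ih, Function.iterate_succ_apply', pow_succ]
    simp

theorem iterate_parity_congr {s t : ℕ} (h : s % 2 = t % 2) (x : Ω) :
    parity^[s] x = parity^[t] x := by
  have key : ∀ s, parity^[s] x = parity^[s % 2] x := by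
    intro s
    conv_lhs => rw [← Nat.mod_add_div s 2, Function.iterate_add_apply, Function.iterate_mul]
    congr 1
    have e : (⇑(parity : Ω →L[ℂ] Ω))^[2] = id := funext fun y => parity_parity y
    rw [e, Function.iterate_id, id]
  rw [key s, key t, h]

theorem iterate_parity_mul (s : ℕ) (x y : Ω) :
    parity^[s] (x * y) = parity^[s] x * parity^[s] y := by
  induction s with
  | zero => rfl
  | succ s ih => simp only [Function.iterate_succ_apply', ih, parity_mul]

theorem nabla_iterate_parity (s : ℕ) (x : Ω) :
    C.nabla (parity^[s] x) = (-1 : ℂ) ^ s • parity^[s] (C.nabla x) := by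
  induction s with
  | zero => simp
  | succ s ih =>
    simp only [Function.iterate_succ_apply', C.nabla_parity, ih, map_smul, pow_succ]
    simp

theorem curvR_iterate_parity (s : ℕ) (x : Ω) :
    C.curvR (parity^[s] x) = parity^[s] (C.curvR x) := by
  induction s with
  | zero => rfl
  | succ s ih => simp only [Function.iterate_succ_apply', C.curvR_parity, ih]

/-! #### Closed supertraces that are homogeneous of degree `p` -/

/-- A linear functional of degree `p` that is a closed supertrace. -/
structure ClosedTrace (p : ℕ) (τ : Ω →L[ℂ] ℂ) : Prop where
  parity_eq : ∀ x, τ (parity x) = (-1) ^ p * τ x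
  mul_comm_eq : ∀ x y, τ (x * y) = τ (parity^[p + 1] y * x)
  nabla_eq : ∀ x, τ (C.nabla x) = 0

/-- The functional `a ↦ τ (p)`, where `p + q X` is obtained from `X a_0` by the
operators `step a_1, …, step a_n`. -/
noncomputable def functional (τ : Ω →L[ℂ] ℂ) (X : Ω →ₗ[ℂ] Ω × Ω) (n : ℕ) (a : Fin (n + 1) → Ω) : ℂ :=
  τ (C.steps (Fin.tail a) (X (a 0))).1

variable {C} {p : ℕ} {τ : Ω →L[ℂ] ℂ}

theorem ClosedTrace.iterate_parity_eq (h : C.ClosedTrace p τ) (k : ℕ) (x : Ω) :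
    τ (parity^[k] x) = (-1) ^ (p * k) * τ x := by
  induction k with
  | zero => simp
  | succ k ih => rw [Function.iterate_succ_apply', h.parity_eq, ih, ← mul_assoc, ← pow_add]; ring_nf

theorem functional_tcons (X : Ω →ₗ[ℂ] Ω × Ω) {n : ℕ} (x : Ω) (l : Fin n → Ω) :
    C.functional τ X n (tcons x l) = τ (C.steps l (X x)).1 := rfl

/-- A left factor can be carried to the right end. The exponent n + p + 1 combines one parity for
each of the n steps with the p + 1 parities of the trace property. -/
theorem ClosedTrace.steps_tact (h : C.ClosedTrace p τ) {n : ℕ} (l : Fin n → Ω) (v : Ω × Ω) (z : Ω) :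
    τ (C.steps l (tact (parity^[n + p + 1] z) v)).1 = τ ((C.steps l v).1 * z) := by
  rw [h.mul_comm_eq, C.steps_tact, tact, ← Function.iterate_add_apply]
  dsimp only
  rw [iterate_parity_congr (by omega : (n + (n + p + 1)) % 2 = (p + 1) % 2)]

/-- The inner contractions telescope by `bar_steps`. The surviving right end is cancelled by the
wrap-around term through the trace property, so only the discrepancy at the first product is left.
It vanishes for the start (a, 0); for `slotStart η` the `cut` kills the second term. -/
theorem ClosedTrace.tb_functional (h : C.ClosedTrace p τ) (X : Ω →ₗ[ℂ] Ω × Ω)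
    (hX : ∀ x y, X (x * y) = tact x (X y)) {n : ℕ} (a : Fin (n + 2) → Ω) :
    tb parity^[n + p + 1] (C.functional τ X n) a = C.functional τ X n (contract 0 a) -
      τ (C.steps (Fin.tail (Fin.tail a)) (cut (a 1) (X (a 0)))).1 := by
  obtain ⟨x, l, rfl⟩ := exists_tcons a
  have hb : ∀ x : Ω, ∀ l : Fin (n + 1) → Ω, bar (fun l' => C.functional τ X n (tcons x l')) l =
      τ (bar C.steps l (X x)).1 := by
    intro x l
    simp only [bar, functional_tcons, LinearMap.sum_apply, LinearMap.smul_apply, Prod.fst_sum,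
      map_sum, Prod.smul_fst, map_smul]
  have e : contract 0 (tcons (parity^[n + p + 1] (tcons x l (Fin.last (n + 1))))
      (Fin.init (tcons x l))) =
      tcons (parity^[n + p + 1] (l (Fin.last n)) * x) (Fin.init l) := by
    rw [init_tcons, contract_zero]; rfl
  have e2 : contract 0 (tcons x l) = tcons (x * l 0) (Fin.tail l) := by
    obtain ⟨y, l, rfl⟩ := exists_tcons l
    rw [contract_zero]; rfl
  rw [tb, bar_cons_fun, hb, bar_steps, e, functional_tcons _ (_ * x), hX, h.steps_tact, e2, pow_succ]
  simp only [LinearMap.sub_apply, LinearMap.smul_apply, Module.End.mul_apply, Prod.fst_sub,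
    Prod.smul_fst, map_sub, map_smul, cut_apply, smul_eq_mul, tail_tcons]
  rw [show tcons x l 1 = l 0 from rfl, tcons_zero]
  ring

/-- Integration by parts: a differential acting on the element after the front one is rewritten with
`conn`, which is moved through the other steps until τ∘∇ = 0 turns it into a differential of the
last element. -/
theorem ClosedTrace.lam_functional (h : C.ClosedTrace p τ) (n : ℕ) :
    lam parity^[n + p + 1] (C.functional τ (LinearMap.inl ℂ Ω Ω) n) =
      C.functional τ (LinearMap.inl ℂ Ω Ω) n := by
  funext a
  obtain ⟨l, z, rfl⟩ := exists_tsnoc a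
  rw [lam_snoc, functional_tcons]
  rcases n with _ | n
  · have e : tsnoc l z = tcons z l := by
      funext i; rw [Fin.fin_one_eq_zero i]; rfl
    rw [e, functional_tcons]
    simp only [steps, Module.End.one_apply, LinearMap.inl_apply, h.iterate_parity_eq]
    rcases Nat.even_or_odd p with hp | hp
    · simp [(hp.mul_right _).neg_one_pow]
    · simp [((hp.add_one).mul_left p).neg_one_pow]
  · obtain ⟨x, l, rfl⟩ := exists_tcons l
    -- With zero second coordinate, the front element is just a left factor of -conn (x, 0), and it
    -- can be sent to the right end by the trace property.
    have e1 : C.step x (LinearMap.inl ℂ Ω Ω (parity^[n + 1 + p + 1] z)) =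
        tact (parity^[n + p + 1] z) (-C.conn (x, 0)) := by
      simp only [step_apply, conn_apply, tact, LinearMap.inl_apply, ← Function.iterate_succ_apply'
        (parity : Ω →L[ℂ] Ω), map_zero, add_zero, zero_mul, C.curvR_mul, Prod.neg_mk, neg_neg,
        mul_neg]
      rw [iterate_parity_congr (by omega : (n + 1 + p + 1).succ % 2 = (n + p + 1) % 2),
        iterate_parity_congr (by omega : (n + 1 + p + 1) % 2 = (n + p + 1).succ % 2)]
    have e2 : C.conn * C.steps l = (-1 : ℂ) ^ n • (C.steps l * C.conn) := by
      -- The tuple is extended by zero to a sequence; only its first n entries occur.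
      have := C.conn_mul_seg (fun j => if hj : j < n then l ⟨j, hj⟩ else 0) n 0
      rw [seg_eq_steps] at this
      simpa using this
    have e3 : C.steps l (C.conn (x, 0)) = (-1 : ℂ) ^ n • C.conn (C.steps l (x, 0)) := by
      rw [← Module.End.mul_apply C.conn, e2, LinearMap.smul_apply, smul_smul, ← mul_pow]
      simp
    rw [steps_tcons, Module.End.mul_apply, e1, h.steps_tact, map_neg, e3, ← tcons_tsnoc,
      functional_tcons, steps_tsnoc, Module.End.mul_apply, LinearMap.inl_apply]
    set v := C.steps l (x, 0)
    -- This is the integration by parts.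
    have h4 := h.nabla_eq (v.1 * z)
    rw [C.nabla_mul_parity, map_add] at h4
    simp only [conn_apply, step_apply, Prod.fst_neg, Prod.smul_fst, neg_mul, smul_mul_assoc,
      map_neg, map_smul, add_mul, map_add, smul_eq_mul, pow_succ]
    have := neg_one_sq_pow n
    linear_combination (-τ (C.nabla v.1 * z) + τ (v.2 * z)) * this - h4

end NCChain

/-! ### The derivative along `ad_η` as a sum of rotations. -/

namespace NCChain

open TwistedCyclic

variable {Ω : Type*} [NonUnitalRing Ω] [Module ℂ Ω] [IsScalarTower ℂ Ω Ω] [SMulCommClass ℂ Ω Ω]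
  [TopologicalSpace Ω] [SuperAlgebra Ω] {𝓕 : SuperFiltration Ω} (C : NCChain 𝓕)

/-- The linear map `a ↦ (0, a^ η)`, where `a^` is the image of `a` under the parity
automorphism. -/
def slotStart (η : Ω) : Ω →ₗ[ℂ] Ω × Ω := slot η ∘ₗ LinearMap.inl ℂ Ω Ω

/-- The derivative of `steps` along the variation `ad_η` of the connection. -/
def dsteps (η : Ω) : {k : ℕ} → (Fin k → Ω) → Module.End ℂ (Ω × Ω)
  | 0, _ => 0
  | _ + 1, a => dsteps η (Fin.tail a) * C.step (a 0) + C.steps (Fin.tail a) * C.dstep η (a 0)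

theorem dseg_eq_dsteps (η : Ω) (b : ℕ → Ω) :
    ∀ k i, C.dseg η b i k = C.dsteps η fun j : Fin k => b (i + j)
  | 0, _ => rfl
  | k + 1, i => by
    have e : (fun j : Fin k => b (i + 1 + j)) = Fin.tail fun j : Fin (k + 1) => b (i + j) := by
      funext j
      simp only [Fin.tail, Fin.val_succ]
      congr 1
      ring
    rw [dseg, dseg_eq_dsteps η b k (i + 1), dsteps, seg_eq_steps, e]
    rfl

/-- The derivative of `functional` for the start `a ↦ (a, 0)` along the variation `ad_η` of the
connection. -/
noncomputable def dfunctional (τ : Ω →L[ℂ] ℂ) (η : Ω) (n : ℕ) (a : Fin (n + 1) → Ω) : ℂ :=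
  τ (C.dsteps η (Fin.tail a) (a 0, 0)).1

/-- On a sequence with period n + 1 up to the twist σ, rotating a tuple amounts to shifting the
window that is read off. -/
theorem mu_iterate {A : Type*} {σ : A → A} {n : ℕ} (f : (Fin (n + 1) → A) → ℂ) {b : ℕ → A}
    (hb : ∀ j, b (j + (n + 1)) = σ (b j)) (j i : ℕ) :
    (mu σ)^[j] f (fun k => b (i + k)) = (-1) ^ (n * j) * f fun k => b (i + j + k) := by
  induction j generalizing i with
  | zero => simp
  | succ j ih =>
    have e : tsnoc (Fin.tail fun k : Fin (n + 1) => b (i + k)) (σ (b (i + (0 : Fin (n + 1))))) =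
        fun k : Fin (n + 1) => b (i + 1 + k) := by
      funext k
      refine Fin.lastCases ?_ (fun k => ?_) k
      · rw [tsnoc_last, ← hb]
        simp only [Fin.val_last, Fin.val_zero]
        congr 1
        ring
      · simp only [tsnoc, Fin.snoc_castSucc, Fin.tail, Fin.val_succ, Fin.val_castSucc]
        congr 1
        ring
    rw [Function.iterate_succ_apply', mu, e, ih, ← mul_assoc, ← pow_add]
    have e2 : i + 1 + j = i + (j + 1) := by ring
    rw [e2]
    congr 2
    ring

variable {C} {p : ℕ} {τ : Ω →L[ℂ] ℂ}

theorem ClosedTrace.iterate_parity_mul (h : C.ClosedTrace p τ) (n k : ℕ) (x y : Ω) :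
    τ (parity^[k] x * parity^[n + p + 1] y) = (-1) ^ (p * k) * τ (parity^[n + k] y * x) := by
  have e : parity^[k] x * parity^[n + p + 1] y = parity^[k] (x * parity^[n + p + 1 + k] y) := by
    rw [NCChain.iterate_parity_mul, ← Function.iterate_add_apply,
      iterate_parity_congr (by omega : (k + (n + p + 1 + k)) % 2 = (n + p + 1) % 2)]
  rw [e, h.iterate_parity_eq, h.mul_comm_eq, ← Function.iterate_add_apply,
      iterate_parity_congr (by omega : (p + 1 + (n + p + 1 + k)) % 2 = (n + k) % 2)]

/-- In the term of `dseg_eq` with η next to b_{i+1}, the part built from b_0, …, b_i is a left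
factor of the part starting at b_{i+1}. The trace property carries it to the right end, where it
reappears as the twisted entries σ b_0, …, σ b_i of the rotated tuple. -/
theorem ClosedTrace.rotated_slot (h : C.ClosedTrace p τ) (η : Ω) {n : ℕ} {b : ℕ → Ω}
    (hb : ∀ j, b (j + (n + 1)) = parity^[n + p + 1] (b j)) {i : ℕ} (hi : i < n) :
    (-1) ^ (n * (i + 1)) * C.functional τ (slotStart η) n (fun k => b (i + 1 + k)) =
      τ (((-1 : ℂ) ^ i • (C.seg b (1 + i + 1) (n - 1 - i) * (slot η * cut (b (1 + i))) *
        C.seg b 1 i * C.conn + (-1 : ℂ) ^ n • (C.conn * (C.seg b (1 + i + 1) (n - 1 - i) *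
          (slot η * cut (b (1 + i))) * C.seg b 1 i)))) (b 0, 0)).1 := by
  obtain ⟨m, rfl⟩ : ∃ m, n = m + 1 + i := ⟨n - 1 - i, by omega⟩
  have em : m + 1 + i - 1 - i = m := by omega
  rw [em, add_comm 1 i]
  set U := C.seg b (i + 1 + 1) m with hU
  set V := C.seg b 1 i with hV
  set s := m + 1 + i + p + 1 with hs
  set c := parity^[s] (b 0) with hc
  set u := U (slot η (b (i + 1), 0)) with hu
  have hL : C.functional τ (slotStart η) (m + 1 + i) (fun k => b (i + 1 + k)) =
      τ (C.steps (fun j : Fin i => parity^[s] (b (1 + j))) (C.step c u)).1 := by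
    have e1 : Fin.tail (fun k : Fin (m + 1 + i + 1) => b (i + 1 + k)) =
        fun j : Fin (m + 1 + i) => b (i + 1 + 1 + j) := by
      funext j
      simp only [Fin.tail, Fin.val_succ]
      congr 1
      ring
    have e2 : C.seg b (i + 1 + 1 + (m + 1)) i =
        C.steps (fun j : Fin i => parity^[s] (b (1 + j))) := by
      rw [seg_eq_steps]
      congr 1
      funext j
      rw [← hb]
      congr 1
      ring
    have e3 : b (i + 1 + 1 + m) = c := by
      rw [hc, ← hb]
      congr 1
      ring
    rw [functional, e1, ← seg_eq_steps, seg_add, seg_succ, e2, e3]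
    rfl
  -- The step by c = σ b_0 separates the two coordinates of u. The coordinate u.1 meets (∇c, -cω), a
  -- sign times a twist of `conn (b 0, 0)`; these two summands match the two summands with `conn` on
  -- the other side.
  have hstep : C.step c u = tact (parity u.1) (C.nabla c, -C.curvR c) + tact u.2 (c, 0) := by
    simp [step_apply, tact, parity_parity, C.curvR_mul]
  have hc1 : (C.nabla c, -C.curvR c) = (-1 : ℂ) ^ (s + 1) • (flip ^ s) (C.conn (b 0, 0)) := by
    refine Prod.ext ?_ ?_
    · rw [Prod.smul_fst, fst_flip_pow, conn_apply, hc, nabla_iterate_parity, pow_succ (-1 : ℂ) s]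
      simp [iterate_map_neg]
    · rw [Prod.smul_snd, snd_flip_pow, conn_apply, hc, curvR_iterate_parity, smul_smul, pow_succ (-1 : ℂ) s,
        mul_right_comm, ← mul_pow]
      simp
  have hc2 : (c, (0 : Ω)) = (flip ^ s) (b 0, 0) := by
    refine Prod.ext ?_ ?_
    · rw [fst_flip_pow]
    · rw [snd_flip_pow]
      simp [iterate_map_zero]
  have hflip : ∀ w, (C.steps (fun j : Fin i => parity^[s] (b (1 + j))) ((flip ^ s) w)).1 =
      (-1 : ℂ) ^ (i * s) • parity^[s] (V w).1 := by
    intro w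
    have := C.steps_iterate_parity_flip s (fun j : Fin i => b (1 + j))
    rw [← Module.End.mul_apply, this, ← seg_eq_steps, LinearMap.smul_apply, Prod.smul_fst,
      Module.End.mul_apply, fst_flip_pow]
  -- Here `cut` leaves only the first coordinate of V w, which then commutes with everything that
  -- follows, up to parity.
  have hW : ∀ w, (U * (slot η * cut (b (i + 1))) * V) w = tact (parity^[m] (V w).1) u := by
    intro w
    have e : cut (b (i + 1)) (V w) = tact (V w).1 (b (i + 1), 0) := by simp [cut_apply, tact]
    simp only [Module.End.mul_apply]
    rw [e, slot_tact, hU, seg_tact]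
  have hR : τ (((-1 : ℂ) ^ i • (U * (slot η * cut (b (i + 1))) * V * C.conn +
      (-1 : ℂ) ^ (m + 1 + i) • (C.conn * (U * (slot η * cut (b (i + 1))) * V)))) (b 0, 0)).1 =
      (-1) ^ i * (τ (parity^[m] (V (C.conn (b 0, 0))).1 * u.1) + (-1) ^ (m + 1 + i) *
        τ (parity^[m + 1] (V (b 0, 0)).1 * u.2)) := by
    rw [LinearMap.smul_apply, LinearMap.add_apply, LinearMap.smul_apply, Module.End.mul_apply _ C.conn,
      Module.End.mul_apply C.conn, hW, hW, C.conn_apply (tact _ _)]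
    -- Under the trace the first coordinate of `conn` loses its ∇ part, so only the second
    -- coordinate of its argument contributes.
    simp only [tact, Prod.smul_fst, Prod.fst_add, map_smul, map_add, map_neg, h.nabla_eq,
      smul_eq_mul, neg_zero, zero_add, Function.iterate_succ_apply']
  rw [hR, hL, hstep, map_add, C.steps_tact, C.steps_tact, hc1, hc2, map_smul, tact, tact, Prod.fst_add,
    map_add]
  dsimp only
  rw [Prod.smul_fst, hflip, hflip, smul_smul, mul_smul_comm, mul_smul_comm, map_smul, map_smul,
    ← Function.iterate_succ_apply (parity : Ω →L[ℂ] Ω), hs, h.iterate_parity_mul,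
    h.iterate_parity_mul,
    iterate_parity_congr (by omega : (m + 1 + i + i.succ) % 2 = m % 2),
    iterate_parity_congr (by omega : (m + 1 + i + i) % 2 = (m + 1) % 2)]
  simp only [smul_eq_mul]
  -- The two sides now agree up to signs that depend only on the parities of m, i and p.
  rcases Nat.even_or_odd m with hm | hm <;> rcases Nat.even_or_odd i with hi | hi <;>
    rcases Nat.even_or_odd p with hp | hp <;>
    simp [pow_add, pow_mul, pow_succ, hm.neg_one_pow, hi.neg_one_pow, hp.neg_one_pow, mul_add,
      Nat.succ_eq_add_one, add_mul]

theorem ClosedTrace.dfunctional_eq_sum (h : C.ClosedTrace p τ) {η : Ω} (ho : parity η = -η) (n : ℕ) :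
    C.dfunctional τ η n = ∑ j ∈ Finset.range (n + 1),
      (mu parity^[n + p + 1])^[j] (C.functional τ (slotStart η) n) := by
  funext a
  -- The tuple is continued to a sequence in which advancing by n + 1 places applies the twist.
  set b : ℕ → Ω := fun j =>
    (parity^[n + p + 1])^[j / (n + 1)] (a ⟨j % (n + 1), Nat.mod_lt _ n.succ_pos⟩) with hb
  have hb1 : ∀ j, b (j + (n + 1)) = parity^[n + p + 1] (b j) := by
    intro j
    simp only [hb, Nat.add_div_right _ n.succ_pos, Nat.add_mod_right, Function.iterate_succ_apply']
  have hb0 : a = fun k : Fin (n + 1) => b (0 + k) := by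
    funext k
    simp only [hb, zero_add, Nat.div_eq_of_lt k.2, Nat.mod_eq_of_lt k.2, Function.iterate_zero, id]
  have ht : Fin.tail a = fun k : Fin n => b (1 + k) := by
    funext k
    rw [hb0]
    simp only [Fin.tail, Fin.val_succ]
    congr 1
    ring
  have h0 : a 0 = b 0 := by rw [hb0]; simp
  rw [Finset.sum_apply, Finset.sum_range_succ', dfunctional, ht, ← dseg_eq_dsteps, dseg_eq _ ho, h0]
  have hj : ∀ j ∈ Finset.range n, (mu parity^[n + p + 1])^[j + 1] (C.functional τ (slotStart η) n) a =
      (-1) ^ (n * (j + 1)) * C.functional τ (slotStart η) n fun k => b (j + 1 + k) := by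
    intro j _
    rw [hb0, mu_iterate _ hb1, zero_add]
  rw [Finset.sum_congr rfl fun j hj' => (hj j hj').trans (h.rotated_slot η hb1 (Finset.mem_range.1 hj')),
    LinearMap.add_apply, LinearMap.sum_apply, Prod.fst_add, map_add, Prod.fst_sum, map_sum, add_comm]
  congr 1
  -- The commutator with `slot η` supplies the unrotated term: its second half has zero first
  -- coordinate.
  rw [LinearMap.sub_apply, Prod.fst_sub, Module.End.mul_apply, Module.End.mul_apply, slot_apply η
    (C.seg b 1 n _), sub_zero, Function.iterate_zero, id, functional, ht, ← seg_eq_steps, h0]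
  rfl

end NCChain

/-! ### Cochains that are homogeneous with respect to parity -/

namespace CyclicCohomology

open TwistedCyclic

/-! ### Cochains under contraction and rotation of their arguments. -/

section Substitution

variable {A : Type*} [NonUnitalRing A] [Module ℂ A] [TopologicalSpace A]

/-- A continuous substitution of tuples that changes the entries linearly, one at a time. -/
def IsSubstitution {m m' : ℕ} (Ψ : (Fin m → A) → (Fin m' → A)) : Prop :=
  Continuous Ψ ∧ ∀ a j, ∃ k, ∃ T : A →ₗ[ℂ] A, ∀ x,
    Ψ (Function.update a j x) = Function.update (Ψ a) k (T x)

theorem IsSubstitution.comp_mem {m m' : ℕ} {Ψ : (Fin (m + 1) → A) → (Fin (m' + 1) → A)}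
    (h : IsSubstitution Ψ) {f : (Fin (m' + 1) → A) → ℂ} (hf : f ∈ cochains A m') :
    f ∘ Ψ ∈ cochains A m := by
  obtain ⟨g, rfl⟩ := hf
  refine ⟨⟨MultilinearMap.mk' (fun a => g (Ψ a)) (fun a i x y => ?_) (fun a i c x => ?_), ?_⟩, rfl⟩
  · obtain ⟨k, T, hT⟩ := h.2 a i
    simp only [hT, map_add, g.map_update_add]
  · obtain ⟨k, T, hT⟩ := h.2 a i
    simp only [hT, map_smul, g.map_update_smul]
  · exact g.cont.comp h.1

theorem update_tcons_zero {m : ℕ} (x y : A) (l : Fin m → A) :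
    Function.update (tcons x l) 0 y = tcons y l :=
  Fin.update_cons_zero (α := fun _ => A) x l y

theorem update_tcons_succ {m : ℕ} (x y : A) (l : Fin m → A) (j : Fin m) :
    Function.update (tcons x l) j.succ y = tcons x (Function.update l j y) :=
  (Fin.cons_update (α := fun _ => A) x l j y).symm

theorem update_tsnoc_last {m : ℕ} (l : Fin m → A) (x y : A) :
    Function.update (tsnoc l x) (Fin.last m) y = tsnoc l y :=
  Fin.update_snoc_last (α := fun _ => A) x l y

theorem update_tsnoc_castSucc {m : ℕ} (l : Fin m → A) (x y : A) (j : Fin m) :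
    Function.update (tsnoc l x) j.castSucc y = tsnoc (Function.update l j y) x :=
  (Fin.snoc_update (α := fun _ => A) x l j y).symm

theorem isSubstitution_contract [IsScalarTower ℂ A A] [SMulCommClass ℂ A A] [ContinuousMul A]
    {m : ℕ} (i : Fin m) : IsSubstitution (contract (A := A) i.castSucc) := by
  constructor
  · refine continuous_pi fun k => ?_
    unfold contract Fin.contractNth
    split_ifs <;> fun_prop
  · intro a j
    induction m with
    | zero => exact i.elim0
    | succ m ih =>
      obtain ⟨x, a, rfl⟩ := exists_tcons a
      refine Fin.cases ?_ (fun i => ?_) i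
      · obtain ⟨y, l, rfl⟩ := exists_tcons a
        rw [Fin.castSucc_zero, contract_zero]
        refine Fin.cases ?_ (fun j => ?_) j
        · exact ⟨0, LinearMap.mulRight ℂ y, fun z => by
            rw [update_tcons_zero, contract_zero, update_tcons_zero]; rfl⟩
        · refine Fin.cases ?_ (fun j => ?_) j
          · exact ⟨0, LinearMap.mulLeft ℂ x, fun z => by
              rw [update_tcons_succ, update_tcons_zero, contract_zero, update_tcons_zero]; rfl⟩
          · exact ⟨j.succ, LinearMap.id, fun z => by
              rw [update_tcons_succ, update_tcons_succ, contract_zero, update_tcons_succ]; rfl⟩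
      · rw [← Fin.succ_castSucc, contract_succ]
        refine Fin.cases ?_ (fun j => ?_) j
        · exact ⟨0, LinearMap.id, fun z => by
            rw [update_tcons_zero, contract_succ, update_tcons_zero]; rfl⟩
        · obtain ⟨k, T, hT⟩ := ih i a j
          exact ⟨k.succ, T, fun z => by
            rw [update_tcons_succ, contract_succ, hT, update_tcons_succ]⟩

theorem isSubstitution_rotate (T : A →L[ℂ] A) (m : ℕ) :
    IsSubstitution fun a : Fin (m + 1) → A => tcons (T (a (Fin.last m))) (Fin.init a) := by
  constructor
  · refine continuous_pi fun k => ?_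
    refine Fin.cases ?_ (fun k => ?_) k
    · exact T.continuous.comp (continuous_apply _)
    · exact continuous_apply _
  · intro a j
    obtain ⟨l, z, rfl⟩ := exists_tsnoc a
    refine Fin.lastCases ?_ (fun j => ?_) j
    · exact ⟨0, T.toLinearMap, fun x => by
        rw [update_tsnoc_last]; dsimp only; rw [tsnoc_last, init_tsnoc, tsnoc_last, init_tsnoc, update_tcons_zero]
        rfl⟩
    · exact ⟨j.succ, LinearMap.id, fun x => by
        rw [update_tsnoc_castSucc]; dsimp only; rw [tsnoc_last, init_tsnoc, tsnoc_last, init_tsnoc,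
          update_tcons_succ]
        rfl⟩

theorem isSubstitution_rotate_symm (T : A →L[ℂ] A) (m : ℕ) :
    IsSubstitution fun a : Fin (m + 1) → A => tsnoc (Fin.tail a) (T (a 0)) := by
  constructor
  · refine continuous_pi fun k => ?_
    refine Fin.lastCases ?_ (fun k => ?_) k
    · simp only [tsnoc_last]
      exact T.continuous.comp (continuous_apply _)
    · simp only [tsnoc, Fin.snoc_castSucc]
      exact continuous_apply _
  · intro a j
    obtain ⟨x, l, rfl⟩ := exists_tcons a
    refine Fin.cases ?_ (fun j => ?_) j
    · exact ⟨Fin.last m, T.toLinearMap, fun y => by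
        rw [update_tcons_zero]; dsimp only; rw [tail_tcons, tail_tcons, update_tsnoc_last]; rfl⟩
    · exact ⟨j.castSucc, LinearMap.id, fun y => by
        rw [update_tcons_succ]; dsimp only; rw [tail_tcons, tail_tcons, update_tsnoc_castSucc]; rfl⟩

end Substitution

variable {A : Type*} [NonUnitalRing A] [Module ℂ A] [TopologicalSpace A] [SuperAlgebra A]

variable (A) in
/-- The cochains that are homogeneous of degree `q` with respect to parity. -/
def homogeneousCochains (q n : ℕ) : Submodule ℂ ((Fin (n + 1) → A) → ℂ) where
  carrier := {f | f ∈ cochains A n ∧ ∀ a, f (fun k => parity (a k)) = (-1) ^ q * f a}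
  add_mem' := by
    rintro f g ⟨hf, hf'⟩ ⟨hg, hg'⟩
    exact ⟨add_mem hf hg, fun a => by simp only [Pi.add_apply, hf', hg', mul_add]⟩
  zero_mem' := ⟨zero_mem _, fun a => by simp⟩
  smul_mem' := by
    rintro c f ⟨hf, hf'⟩
    exact ⟨Submodule.smul_mem _ c hf, fun a => by
      simp only [Pi.smul_apply, hf', smul_eq_mul, mul_left_comm]⟩

/-- The parity automorphism, applied `s` times. -/
def parityPow (s : ℕ) : A →L[ℂ] A := (parity : A →L[ℂ] A) ^ s

theorem parityPow_apply (s : ℕ) (x : A) : parityPow s x = parity^[s] x := by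
  rw [parityPow, FunLike.coe_pow_eq_iterate]

theorem parity_iterate_comm (s : ℕ) (x : A) : parity (parity^[s] x) = parity^[s] (parity x) :=
  (Function.iterate_succ_apply' parity s x).symm.trans (Function.iterate_succ_apply parity s x)

theorem comp_mem_homogeneousCochains {m m' q : ℕ} {Ψ : (Fin (m + 1) → A) → (Fin (m' + 1) → A)}
    (h : IsSubstitution Ψ) (hp : ∀ a, Ψ (fun k => parity (a k)) = fun k => parity (Ψ a k))
    {f : (Fin (m' + 1) → A) → ℂ} (hf : f ∈ homogeneousCochains A q m') :
    f ∘ Ψ ∈ homogeneousCochains A q m :=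
  ⟨h.comp_mem hf.1, fun a => by simp only [Function.comp_apply, hp, hf.2]⟩

theorem contract_parity {m : ℕ} (i : Fin (m + 1)) (a : Fin (m + 1) → A) :
    contract i (fun k => parity (a k)) = fun k => parity (contract i a k) :=
  (Fin.comp_contractNth (· * ·) (· * ·) (f := (parity : A →L[ℂ] A))
    (fun x y => parity_mul x y) i a).symm

theorem rotate_parity {m : ℕ} (s : ℕ) (a : Fin (m + 1) → A) :
    tcons (parity^[s] (parity (a (Fin.last m)))) (Fin.init fun k => parity (a k)) =
      fun k => parity (tcons (parity^[s] (a (Fin.last m))) (Fin.init a) k) := by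
  funext k
  refine Fin.cases ?_ (fun k => ?_) k
  · exact (parity_iterate_comm s _).symm
  · rfl

theorem rotate_symm_parity {m : ℕ} (s : ℕ) (a : Fin (m + 1) → A) :
    tsnoc (Fin.tail fun k => parity (a k)) (parity^[s] (parity (a 0))) =
      fun k => parity (tsnoc (Fin.tail a) (parity^[s] (a 0)) k) := by
  funext k
  refine Fin.lastCases ?_ (fun k => ?_) k
  · rw [tsnoc_last, tsnoc_last, parity_iterate_comm]
  · simp only [tsnoc, Fin.snoc_castSucc]
    rfl

theorem mu_mem {q n s : ℕ} {f : (Fin (n + 1) → A) → ℂ} (hf : f ∈ homogeneousCochains A q n) :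
    mu parity^[s] f ∈ homogeneousCochains A q n := by
  have h := isSubstitution_rotate_symm (parityPow s : A →L[ℂ] A) n
  simp only [parityPow_apply] at h
  exact Submodule.smul_mem _ ((-1) ^ n)
    (comp_mem_homogeneousCochains h (fun a => rotate_symm_parity s a) hf)

theorem mu_iterate_mem {q n s : ℕ} {f : (Fin (n + 1) → A) → ℂ}
    (hf : f ∈ homogeneousCochains A q n) (j : ℕ) :
    (mu parity^[s])^[j] f ∈ homogeneousCochains A q n := by
  induction j with
  | zero => exact hf
  | succ j ih => rw [Function.iterate_succ_apply']; exact mu_mem ih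

/-! ### Stability of homogeneous cochains under the coboundary operators. -/

section Closure

variable [IsScalarTower ℂ A A] [SMulCommClass ℂ A A] [ContinuousMul A]

theorem comp_contract_mem {q n : ℕ} {f : (Fin (n + 1) → A) → ℂ}
    (hf : f ∈ homogeneousCochains A q n) (i : Fin (n + 1)) :
    (fun a => f (contract i.castSucc a)) ∈ homogeneousCochains A q (n + 1) :=
  comp_mem_homogeneousCochains (isSubstitution_contract i) (fun a => contract_parity _ a) hf

theorem bar_mem {q n : ℕ} {f : (Fin (n + 1) → A) → ℂ} (hf : f ∈ homogeneousCochains A q n) :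
    bar f ∈ homogeneousCochains A q (n + 1) := by
  have : bar f = ∑ i : Fin (n + 1), (-1 : ℂ) ^ (i : ℕ) • fun a => f (contract i.castSucc a) := by
    funext a; simp [bar, Finset.sum_apply]
  rw [this]
  exact Submodule.sum_mem _ fun i _ => Submodule.smul_mem _ _ (comp_contract_mem hf i)

theorem wbar_mem {q n : ℕ} {f : (Fin (n + 1) → A) → ℂ} (hf : f ∈ homogeneousCochains A q n) :
    wbar f ∈ homogeneousCochains A q (n + 1) := by
  have : wbar f = ∑ i : Fin (n + 1), ((((n + 1 : ℕ) : ℂ) - i) * (-1 : ℂ) ^ (i : ℕ)) •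
      fun a => f (contract i.castSucc a) := by
    funext a; simp [wbar, Finset.sum_apply]
  rw [this]
  exact Submodule.sum_mem _ fun i _ => Submodule.smul_mem _ _ (comp_contract_mem hf i)

theorem tb_mem {q n s : ℕ} {f : (Fin (n + 1) → A) → ℂ} (hf : f ∈ homogeneousCochains A q n) :
    tb parity^[s] f ∈ homogeneousCochains A q (n + 1) := by
  have h := isSubstitution_rotate (parityPow s : A →L[ℂ] A) (n + 1)
  simp only [parityPow_apply] at h
  exact add_mem (bar_mem hf) (Submodule.smul_mem _ ((-1) ^ (n + 1))
    (comp_mem_homogeneousCochains h (fun a => rotate_parity s a) (comp_contract_mem hf 0)))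

end Closure

/-! #### The frozen operators on homogeneous cochains -/

theorem parity_iterate_iterate (s : ℕ) (x : A) : parity^[s] (parity^[s] x) = x := by
  induction s generalizing x with
  | zero => rfl
  | succ s ih =>
    rw [Function.iterate_succ_apply, Function.iterate_succ_apply', parity_parity, ih]

theorem parity_iterate_mul (s : ℕ) (x y : A) :
    parity^[s] (x * y) = parity^[s] x * parity^[s] y := by
  induction s with
  | zero => rfl
  | succ s ih => simp only [Function.iterate_succ_apply', ih, parity_mul]

theorem parity_iterate_of_even {s : ℕ} (h : Even s) (x : A) : parity^[s] x = x := by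
  obtain ⟨r, rfl⟩ := h
  rw [Function.iterate_add_apply, parity_iterate_iterate]

theorem parity_iterate_of_odd {s : ℕ} (h : Odd s) (x : A) : parity^[s] x = parity x := by
  obtain ⟨r, rfl⟩ := h
  exact (Function.iterate_succ_apply' parity (2 * r) x).trans
    (congrArg parity (parity_iterate_of_even (even_two_mul r) x))

/-- On functions that are linear in the first variable and homogeneous, the rotation has a simple
form. -/
theorem rotate_eq_of_linear {q n : ℕ} (F : (Fin (n + 1) → A) → ℂ)
    (hadd : ∀ x y l, F (tcons (x + y) l) = F (tcons x l) + F (tcons y l))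
    (hneg : ∀ x l, F (tcons (-x) l) = -F (tcons x l))
    (hp : ∀ a, F (fun k => parity (a k)) = (-1) ^ q * F a) (a : Fin (n + 1) → A) :
    rotate F a = F (tcons (parity^[q + 1] (a (Fin.last n))) (Fin.init a)) := by
  set z := a (Fin.last n)
  set l : Fin n → A := Fin.init a
  have ho : parity (oddPart z) = -oddPart z := by simpa [HasParity] using hasParity_oddPart z
  have he : parity (evenPart z) = evenPart z := by simpa [HasParity] using hasParity_evenPart z
  have h1 : F (tcons (oddPart z) fun k => parity (l k)) =
      (-1) ^ (q + 1) * F (tcons (oddPart z) l) := by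
    have h := hp (tcons (-oddPart z) l)
    have e : (fun k => parity (tcons (-oddPart z) l k)) =
        tcons (oddPart z) fun k => parity (l k) := by
      funext k
      refine Fin.cases ?_ (fun k => ?_) k
      · simp [ho]
      · rfl
    rw [e, hneg] at h
    rw [h, pow_succ]
    ring
  have h2 : parity^[q + 1] z = evenPart z + parity^[q + 1] (oddPart z) := by
    conv_lhs => rw [← evenPart_add_oddPart z]
    rw [iterate_map_add]
    congr 1
    rcases Nat.even_or_odd (q + 1) with h | h
    · exact parity_iterate_of_even h _
    · rw [parity_iterate_of_odd h, he]
  have h3 : rotate F a = F (tcons (evenPart z) l) + F (tcons (oddPart z) fun k => parity (l k)) :=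
    rfl
  rw [h3, h1, h2, hadd]
  congr 1
  rcases Nat.even_or_odd (q + 1) with h | h
  · rw [parity_iterate_of_even h, h.neg_one_pow, one_mul]
  · rw [parity_iterate_of_odd h, h.neg_one_pow, ho, hneg, neg_one_mul]

theorem tcons_add_of_mem {n : ℕ} {f : (Fin (n + 1) → A) → ℂ} (hf : f ∈ cochains A n) (x y : A)
    (l : Fin n → A) : f (tcons (x + y) l) = f (tcons x l) + f (tcons y l) := by
  obtain ⟨g, rfl⟩ := hf
  exact g.cons_add l x y

theorem tcons_neg_of_mem {n : ℕ} {f : (Fin (n + 1) → A) → ℂ} (hf : f ∈ cochains A n) (x : A)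
    (l : Fin n → A) : f (tcons (-x) l) = -f (tcons x l) := by
  obtain ⟨g, rfl⟩ := hf
  have := g.cons_smul l (-1) x
  rwa [neg_one_smul, neg_one_smul] at this

/-- A homogeneous tuple contributes only if its total degree is q. The Koszul sign then has exponent
∂a_n (q - ∂a_n) ≡ (q + 1) ∂a_n, which a power of the parity automorphism applied to a_n absorbs. -/
theorem rotate_eq {q n : ℕ} {f : (Fin (n + 1) → A) → ℂ} (hf : f ∈ homogeneousCochains A q n) :
    rotate f = (-1 : ℂ) ^ n • lam parity^[q + 1] f := by
  funext a
  rw [rotate_eq_of_linear f (tcons_add_of_mem hf.1) (tcons_neg_of_mem hf.1) hf.2, Pi.smul_apply,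
    lam, smul_eq_mul, neg_one_mul_self]

theorem mem_cyclicCochains_iff {q n : ℕ} {f : (Fin (n + 1) → A) → ℂ}
    (hf : f ∈ homogeneousCochains A q n) :
    f ∈ cyclicCochains A n ↔ lam parity^[q + 1] f = f := by
  have e : f ∈ cyclicCochains A n ↔ rotate f = (-1 : ℂ) ^ n • f :=
    ⟨fun h => h.2, fun h => ⟨hf.1, h⟩⟩
  rw [e, rotate_eq hf]
  exact (smul_right_injective _ (pow_ne_zero n (by norm_num : (-1 : ℂ) ≠ 0))).eq_iff

/-- The wrap-around term rotates c ↦ f(c_0 c_1, …), which is linear in c_0 and again of degree q, so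
its Koszul sign is absorbed in the same way. -/
theorem b_eq {q n : ℕ} {f : (Fin (n + 1) → A) → ℂ} (hf : f ∈ homogeneousCochains A q n) :
    b f = tb parity^[q + 1] f := by
  funext a
  have h : rotate (fun c => f (face 0 c)) a =
      f (contract 0 (tcons (parity^[q + 1] (a (Fin.last (n + 1)))) (Fin.init a))) := by
    refine rotate_eq_of_linear (q := q) (fun c => f (face 0 c)) (fun x y l => ?_) (fun x l => ?_)
      (fun c => ?_) a
    · obtain ⟨z, l, rfl⟩ := exists_tcons l
      have e : ∀ w, face 0 (tcons w (tcons z l)) = tcons (w * z) l := fun w => contract_zero w z l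
      rw [e, e, e, add_mul, tcons_add_of_mem hf.1]
    · obtain ⟨z, l, rfl⟩ := exists_tcons l
      have e : ∀ w, face 0 (tcons w (tcons z l)) = tcons (w * z) l := fun w => contract_zero w z l
      rw [e, e, neg_mul, tcons_neg_of_mem hf.1]
    · rw [← hf.2]
      exact congrArg f (contract_parity _ c)
  exact congrArg (fun z => bar f a + (-1) ^ (n + 1) * z) h

theorem mem_cyclicCocycles_iff {q n : ℕ} {f : (Fin (n + 1) → A) → ℂ}
    (hf : f ∈ homogeneousCochains A q n) :
    f ∈ cyclicCocycles A n ↔ lam parity^[q + 1] f = f ∧ tb parity^[q + 1] f = 0 := by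
  rw [cyclicCocycles, Submodule.mem_inf, mem_cyclicCochains_iff hf, LinearMap.mem_ker, b_eq hf]

theorem S_eq_bibar {n : ℕ} (f : (Fin (n + 1) → A) → ℂ) : S f = bibar f := rfl

/-! ### The periodicity operator on homogeneous cocycles. -/

section Periodicity

variable [IsScalarTower ℂ A A] [SMulCommClass ℂ A A] [ContinuousMul A]

theorem S_mem_cyclicCocycles {q n : ℕ} {f : (Fin (n + 1) → A) → ℂ}
    (hf : f ∈ homogeneousCochains A q n) (hc : f ∈ cyclicCocycles A n) :
    S f ∈ cyclicCocycles A (n + 2) := by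
  obtain ⟨hl, hb⟩ := (mem_cyclicCocycles_iff hf).1 hc
  have hS : S f ∈ homogeneousCochains A q (n + 2) := by
    rw [S_eq_bibar, bibar_eq_tb_wbar hb]
    exact tb_mem (wbar_mem hf)
  rw [mem_cyclicCocycles_iff hS, S_eq_bibar]
  exact ⟨lam_bibar (parity_iterate_mul _) hl hb, tb_bibar (parity_iterate_mul _) hb⟩

/-- The periodicity operator kills the classes of cyclic cocycles that are the sum of all rotations
of a cochain `g` with coboundary `g(a_0 a_1, …)`. -/
theorem S_mem_cyclicCoboundaries {q n : ℕ} {f g : (Fin (n + 1) → A) → ℂ}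
    (hf : f ∈ homogeneousCochains A q n) (hc : f ∈ cyclicCocycles A n)
    (hg : g ∈ homogeneousCochains A q n)
    (hgb : ∀ a, tb parity^[q + 1] g a = g (contract 0 a))
    (hs : f = ∑ j ∈ Finset.range (n + 1), (mu parity^[q + 1])^[j] g) :
    S f ∈ cyclicCoboundaries A (n + 2) := by
  obtain ⟨hl, hb⟩ := (mem_cyclicCocycles_iff hf).1 hc
  obtain ⟨h1, h2⟩ := bibar_eq_tb_cyclic (parity_iterate_mul (q + 1)) (parity_iterate_iterate _)
    hl hb hgb hs _ rfl
  set θ := wbar f - ((n : ℂ) + 2) • (((n : ℂ) + 1) • tb parity^[q + 1] g + tb parity^[q + 1]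
      (∑ j ∈ Finset.range (n + 1), ∑ i ∈ Finset.range j, (mu parity^[q + 1])^[i + 1] g)) with hθ
  have hθm : θ ∈ homogeneousCochains A q (n + 1) := by
    refine sub_mem (wbar_mem hf) (Submodule.smul_mem _ _ (add_mem (Submodule.smul_mem _ _
      (tb_mem hg)) (tb_mem ?_)))
    exact Submodule.sum_mem _ fun j _ => Submodule.sum_mem _ fun i _ => mu_iterate_mem hg _
  refine ⟨θ, (mem_cyclicCochains_iff hθm).2 h1, ?_⟩
  rw [b_eq hθm, ← h2, S_eq_bibar]

end Periodicity

end CyclicCohomology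

/-! ### Characters of cycles as functionals -/

namespace NCChain

open TwistedCyclic CyclicCohomology

variable {Ω : Type*} [NonUnitalRing Ω] [Module ℂ Ω] [TopologicalSpace Ω] [SuperAlgebra Ω]
  {𝓕 : SuperFiltration Ω}

/-- The homogeneous part of degree `p` of a linear functional. -/
noncomputable def tracePart [ContinuousAdd Ω] (p : ℕ) (τ : Ω →L[ℂ] ℂ) : Ω →L[ℂ] ℂ :=
  (2⁻¹ : ℂ) • (τ + (-1 : ℂ) ^ p • τ.comp parity)

theorem tracePart_apply [ContinuousAdd Ω] (p : ℕ) (τ : Ω →L[ℂ] ℂ) (x : Ω) :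
    tracePart p τ x = 2⁻¹ * (τ x + (-1) ^ p * τ (parity x)) := rfl

theorem tracePart_zero_add_one [ContinuousAdd Ω] (τ : Ω →L[ℂ] ℂ) (x : Ω) :
    tracePart 0 τ x + tracePart 1 τ x = τ x := by
  simp only [tracePart_apply]; ring

theorem tracePart_eq_zero [ContinuousAdd Ω] {p k : ℕ} {τ : Ω →L[ℂ] ℂ}
    (h : ∀ x ∈ 𝓕.F k, τ x = 0) : ∀ x ∈ 𝓕.F k, tracePart p τ x = 0 := fun x hx => by
  rw [tracePart_apply, h x hx, h _ (𝓕.parity_mem k x hx)]; ring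

/-- The part of degree p sees only products with ∂x + ∂y ≡ p, where (-1)^(∂x ∂y) = (-1)^((p + 1)
∂y). -/
theorem _root_.NCCycle.closedTrace [ContinuousAdd Ω] (C : NCCycle 𝓕) (p : ℕ) :
    C.toNCChain.ClosedTrace p (tracePart p C.tau) where
  parity_eq x := by
    simp only [tracePart_apply, parity_parity]
    rcases neg_one_pow_eq_or ℂ p with h | h <;> rw [h] <;> ring
  mul_comm_eq x y := by
    have x0 := hasParity_evenPart x
    have x1 := hasParity_oddPart x
    have y0 := hasParity_evenPart y
    have y1 := hasParity_oddPart y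
    have h00 := C.tau_mul_comm _ _ _ _ x0 y0
    have h01 := C.tau_mul_comm _ _ _ _ x0 y1
    have h10 := C.tau_mul_comm _ _ _ _ x1 y0
    have h11 := C.tau_mul_comm _ _ _ _ x1 y1
    rw [← evenPart_add_oddPart x, ← evenPart_add_oddPart y]
    unfold HasParity at x0 x1 y0 y1
    simp only [pow_zero, one_smul, pow_one, neg_one_smul] at x0 x1 y0 y1
    rcases Nat.even_or_odd p with hp | hp
    · rw [parity_iterate_of_odd (hp.add_one)]
      simp only [tracePart_apply, hp.neg_one_pow, parity_mul, map_add, x0, x1, y0, y1, add_mul,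
        mul_add, mul_neg, neg_mul, map_neg, h00, h01, h10, h11]
      ring
    · rw [parity_iterate_of_even (hp.add_one)]
      simp only [tracePart_apply, hp.neg_one_pow, parity_mul, map_add, x0, x1, y0, y1, add_mul,
        mul_add, mul_neg, neg_mul, map_neg, h00, h01, h10, h11]
      ring
  nabla_eq x := by
    rw [tracePart_apply, C.tau_nabla]
    have := C.tau_nabla (parity x)
    rw [C.nabla_parity, map_neg, neg_eq_zero] at this
    rw [this]; ring

variable [IsScalarTower ℂ Ω Ω] [SMulCommClass ℂ Ω Ω] (C : NCChain 𝓕)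

/-! #### Forms in terms of steps -/

/-- The sign `(-1)^{n(n-1)/2}`. -/
def formSign : ℕ → ℂ
  | 0 => 1
  | n + 1 => (-1) ^ n * formSign n

theorem form_tsnoc (n : ℕ) (l : Fin (n + 1) → Ω) (z : Ω) : C.form (n + 1) (tsnoc l z) =
    C.tildeMul (C.form n l) ⟨C.nabla z, parity z, z, 0⟩ := by
  rw [form, init_tsnoc, tsnoc_last]
  congr 1
  simp [tildeD, incl]

theorem form_c10_c11 (n : ℕ) (a : Fin (n + 1) → Ω) :
    (C.form n a).c10 = 0 ∧ (C.form n a).c11 = 0 := by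
  induction n with
  | zero => exact ⟨rfl, rfl⟩
  | succ n ih =>
    obtain ⟨l, z, rfl⟩ := exists_tsnoc a
    rw [form_tsnoc]
    simp [tildeMul, ih]

/-- Each of the n differentials is odd, and X contributes one more sign to its coefficient. -/
theorem form_parity (n : ℕ) (a : Fin (n + 1) → Ω) :
    (C.form n fun k => parity (a k)).c00 = (-1 : ℂ) ^ n • parity (C.form n a).c00 ∧
    (C.form n fun k => parity (a k)).c01 = (-1 : ℂ) ^ (n + 1) • parity (C.form n a).c01 := by
  induction n with
  | zero => simp [form, incl]
  | succ n ih =>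
    obtain ⟨l, z, rfl⟩ := exists_tsnoc a
    have e : (fun k => parity (tsnoc l z k)) = tsnoc (fun k => parity (l k)) (parity z) := by
      funext k
      refine Fin.lastCases ?_ (fun k => ?_) k <;> simp [tsnoc]
    rw [e, form_tsnoc, form_tsnoc]
    simp only [tildeMul, ih, C.nabla_parity, C.curvL_parity, map_zero, mul_zero, add_zero, map_add,
      parity_mul, pow_succ, smul_mul_assoc, mul_neg]
    exact ⟨by module, by module⟩

/-- The coefficient of X re-enters Ω only through (qX)(Xa) = qωa, so it suffices to follow it after
multiplication by ω. The parities in the definition of the cocycle turn the parity in `step` into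
the global sign `formSign n`. -/
theorem form_eq_steps (n : ℕ) (a : Fin (n + 1) → Ω) :
    (C.form n fun k => parity^[n - (k : ℕ)] (a k)).c00 =
      formSign n • (C.steps (Fin.tail a) (a 0, 0)).1 ∧
    C.curvR (parity (C.form n fun k => parity^[n - (k : ℕ)] (a k)).c01) =
      -(formSign n • (C.steps (Fin.tail a) (a 0, 0)).2) := by
  induction n with
  | zero => simp [form, incl, steps, formSign]
  | succ n ih =>
    obtain ⟨l, z, rfl⟩ := exists_tsnoc a
    -- Since n + 1 - k = (n - k) + 1, a new last argument costs each earlier one exactly one more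
    -- parity.
    have e : (fun k : Fin (n + 2) => parity^[n + 1 - (k : ℕ)] (tsnoc l z k)) =
        tsnoc (fun k : Fin (n + 1) => parity (parity^[n - (k : ℕ)] (l k))) z := by
      funext k
      refine Fin.lastCases ?_ (fun k => ?_) k
      · simp [tsnoc]
      · simp only [tsnoc, Fin.snoc_castSucc, Fin.val_castSucc]
        rw [Nat.sub_add_comm (by omega), Function.iterate_succ_apply']
    have e0 : tsnoc l z 0 = l 0 := Fin.snoc_castSucc (α := fun _ => Ω) z l 0
    obtain ⟨h1, h2⟩ := ih l
    obtain ⟨p1, p2⟩ := C.form_parity n fun k => parity^[n - (k : ℕ)] (l k)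
    rw [e, form_tsnoc, tail_tsnoc, steps_tsnoc, Module.End.mul_apply, step_apply, e0, formSign]
    simp only [tildeMul, p1, p2, h1, map_zero, mul_zero, add_zero]
    constructor
    · rw [smul_mul_assoc _ _ (C.curvL z), ← C.curvR_mul_right, h2, map_smul]
      simp only [smul_mul_assoc, neg_mul, pow_succ]
      module
    · simp only [parity_mul, parity_parity, smul_mul_assoc, map_smul]
      module

theorem character_eq (n : ℕ) (a : Fin (n + 1) → Ω) :
    C.character n a = formSign n * C.functional C.tau (LinearMap.inl ℂ Ω Ω) n a := by
  rw [character, tildeTau, (C.form_c10_c11 n _).2, map_zero, map_zero, map_zero, sub_zero,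
    (C.form_eq_steps n a).1, map_smul]
  rfl

/-! #### The filtration -/

theorem step_mem {k : ℕ} {v : Ω × Ω} (h1 : v.1 ∈ 𝓕.F k) (h2 : v.2 ∈ 𝓕.F (k + 1)) (a : Ω) :
    (C.step a v).1 ∈ 𝓕.F (k + 1) ∧ (C.step a v).2 ∈ 𝓕.F (k + 2) := by
  have ha : a ∈ 𝓕.F 0 := by rw [𝓕.F_zero]; trivial
  rw [step_apply]
  exact ⟨add_mem (𝓕.mul_mem k 1 _ (𝓕.parity_mem k _ h1) _ (C.nabla_mem 0 a ha))
    (𝓕.mul_mem (k + 1) 0 _ h2 a ha), neg_mem (C.curvR_mem k _ (𝓕.mul_mem k 0 _ h1 a ha))⟩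

theorem step_mem_of_mem {k : ℕ} {v : Ω × Ω} (h1 : v.1 ∈ 𝓕.F k) (h2 : v.2 ∈ 𝓕.F (k + 1)) {a : Ω}
    (ha : a ∈ 𝓕.F 1) : (C.step a v).1 ∈ 𝓕.F (k + 2) ∧ (C.step a v).2 ∈ 𝓕.F (k + 3) := by
  rw [step_apply]
  exact ⟨add_mem (𝓕.mul_mem k 2 _ (𝓕.parity_mem k _ h1) _ (C.nabla_mem 1 a ha))
    (𝓕.mul_mem (k + 1) 1 _ h2 a ha), neg_mem (C.curvR_mem (k + 1) _ (𝓕.mul_mem k 1 _ h1 a ha))⟩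

theorem steps_mem {m k : ℕ} {v : Ω × Ω} (h1 : v.1 ∈ 𝓕.F k) (h2 : v.2 ∈ 𝓕.F (k + 1))
    (a : Fin m → Ω) :
    (C.steps a v).1 ∈ 𝓕.F (k + m) ∧ (C.steps a v).2 ∈ 𝓕.F (k + m + 1) := by
  induction m generalizing k v with
  | zero => exact ⟨h1, h2⟩
  | succ m ih =>
    have h := C.step_mem h1 h2 (a 0)
    have := ih h.1 h.2 (Fin.tail a)
    rwa [add_right_comm k 1 m, add_assoc k m 1] at this

theorem steps_mem_of_mem {m k : ℕ} {v : Ω × Ω} (h1 : v.1 ∈ 𝓕.F k) (h2 : v.2 ∈ 𝓕.F (k + 1))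
    {a : Fin m → Ω} {j : Fin m} (hj : a j ∈ 𝓕.F 1) : (C.steps a v).1 ∈ 𝓕.F (k + m + 1) := by
  induction m generalizing k v with
  | zero => exact j.elim0
  | succ m ih =>
    obtain rfl | ⟨j, rfl⟩ := Fin.eq_zero_or_eq_succ j
    · have h := C.step_mem_of_mem h1 h2 hj
      have := (C.steps_mem h.1 h.2 (Fin.tail a)).1
      rwa [show k + (m + 1) + 1 = k + 2 + m by ring]
    · have h := C.step_mem h1 h2 (a 0)
      have := ih h.1 h.2 (a := Fin.tail a) (j := j) hj
      rwa [show k + (m + 1) + 1 = k + 1 + m + 1 by ring]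

variable (𝓕) in
/-- The linear maps `Ω → Ω ⊕ ΩX` that raise the filtration as much as `a ↦ a` does. -/
structure Start (X : Ω →ₗ[ℂ] Ω × Ω) : Prop where
  cont : Continuous X
  parity_eq : ∀ a, X (parity a) = flip (X a)
  mem : ∀ k, ∀ a ∈ 𝓕.F k, (X a).1 ∈ 𝓕.F k ∧ (X a).2 ∈ 𝓕.F (k + 1)

theorem start_inl : Start 𝓕 (LinearMap.inl ℂ Ω Ω) where
  cont := by
    simp only [LinearMap.coe_inl]
    fun_prop
  parity_eq a := by simp [flip_apply]
  mem k a ha := ⟨ha, zero_mem _⟩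

theorem start_slotStart [ContinuousMul Ω] {η : Ω} (hη : η ∈ 𝓕.F 1) (ho : parity η = -η) :
    Start 𝓕 (slotStart η) where
  cont := by
    have : ⇑(slotStart η) = fun a : Ω => (0, parity a * η) := rfl
    rw [this]
    fun_prop
  parity_eq a := by simp [slotStart, slot_apply, flip_apply, parity_mul, ho]
  mem k a ha := ⟨zero_mem _, 𝓕.mul_mem k 1 _ (𝓕.parity_mem k a ha) η hη⟩

variable {C} {p n : ℕ} {τ : Ω →L[ℂ] ℂ} {X : Ω →ₗ[ℂ] Ω × Ω}

/-- The n steps lead from F_0 to F_{-n}, and an argument in F_{-1} lowers the filtration once more,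
whether it is the starting element or is differentiated. -/
theorem functional_eq_zero (hX : Start 𝓕 X) (hn : ∀ x ∈ 𝓕.F (n + 1), τ x = 0)
    {a : Fin (n + 1) → Ω} {j : Fin (n + 1)} (hj : a j ∈ 𝓕.F 1) : C.functional τ X n a = 0 := by
  refine hn _ ?_
  obtain rfl | ⟨j, rfl⟩ := Fin.eq_zero_or_eq_succ j
  · have := (C.steps_mem (hX.mem 1 _ hj).1 (hX.mem 1 _ hj).2 (Fin.tail a)).1
    rwa [add_comm 1 n] at this
  · have h0 := hX.mem 0 (a 0) (by rw [𝓕.F_zero]; trivial)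
    have := C.steps_mem_of_mem h0.1 h0.2 (a := Fin.tail a) (j := j) hj
    rwa [zero_add] at this

theorem step_add (x y : Ω) : C.step (x + y) = C.step x + C.step y := by
  refine LinearMap.ext fun v => ?_
  rw [LinearMap.add_apply, step_apply, step_apply, step_apply, Prod.mk_add_mk]
  simp only [map_add, mul_add]
  congr 1 <;> abel

theorem step_smul (c : ℂ) (x : Ω) : C.step (c • x) = c • C.step x := by
  refine LinearMap.ext fun v => ?_
  rw [LinearMap.smul_apply, step_apply, step_apply, Prod.smul_mk]
  simp only [map_smul, mul_smul_comm, smul_add, smul_neg]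

theorem exists_multilinear_steps [IsTopologicalRing Ω] (C : NCChain 𝓕) (hX : Continuous X) (n : ℕ) :
    ∃ G : ContinuousMultilinearMap ℂ (fun _ : Fin (n + 1) => Ω) (Ω × Ω),
      ∀ a, G a = C.steps (Fin.tail a) (X (a 0)) := by
  induction n with
  | zero =>
    refine ⟨⟨MultilinearMap.mk' (fun a => X (a 0)) (fun a i x y => ?_) (fun a i c x => ?_),
      hX.comp (continuous_apply 0)⟩, fun a => rfl⟩
    · rw [Fin.fin_one_eq_zero i]; simp
    · rw [Fin.fin_one_eq_zero i]; simp
  | succ n ih =>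
    obtain ⟨G, hG⟩ := ih
    have key : ∀ (l : Fin (n + 1) → Ω) z, C.step (tsnoc l z (Fin.last (n + 1)))
        (G (Fin.init (tsnoc l z))) = C.step z (G l) := fun l z => by
      rw [tsnoc_last, init_tsnoc]
    refine ⟨⟨MultilinearMap.mk' (fun a => C.step (a (Fin.last (n + 1))) (G (Fin.init a)))
      (fun a i x y => ?_) (fun a i c x => ?_), ?_⟩, fun a => ?_⟩
    · obtain ⟨l, z, rfl⟩ := exists_tsnoc a
      refine Fin.lastCases ?_ (fun i => ?_) i
      · simp only [update_tsnoc_last, key, step_add, LinearMap.add_apply]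
      · simp only [update_tsnoc_castSucc, key, G.map_update_add, map_add]
    · obtain ⟨l, z, rfl⟩ := exists_tsnoc a
      refine Fin.lastCases ?_ (fun i => ?_) i
      · simp only [update_tsnoc_last, key, step_smul, LinearMap.smul_apply]
      · simp only [update_tsnoc_castSucc, key, G.map_update_smul, map_smul]
    · have h1 : Continuous fun a : Fin (n + 2) → Ω => G (Fin.init a) :=
        G.cont.comp (continuous_pi fun i => continuous_apply _)
      have h2 : Continuous fun a : Fin (n + 2) → Ω => a (Fin.last (n + 1)) := continuous_apply _
      change Continuous fun a : Fin (n + 2) → Ω => C.step (a (Fin.last (n + 1))) (G (Fin.init a))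
      simp only [step_apply]
      fun_prop
    · obtain ⟨l, z, rfl⟩ := exists_tsnoc a
      change C.step (tsnoc l z (Fin.last (n + 1))) (G (Fin.init (tsnoc l z))) = _
      rw [key, hG, tail_tsnoc, steps_tsnoc, Module.End.mul_apply]
      congr 3

/-- The n odd differentials contribute n to the degree, and the trace contributes p. -/
theorem functional_mem_homogeneousCochains [IsTopologicalRing Ω] (h : C.ClosedTrace p τ)
    (hX : Start 𝓕 X) : C.functional τ X n ∈ homogeneousCochains Ω (n + p) n := by
  constructor
  · obtain ⟨G, hG⟩ := C.exists_multilinear_steps hX.cont n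
    exact ⟨(τ.comp (ContinuousLinearMap.fst ℂ Ω Ω)).compContinuousMultilinearMap G,
      funext fun a => congrArg (fun v : Ω × Ω => τ v.1) (hG a)⟩
  · intro a
    have e := LinearMap.congr_fun (C.steps_parity_flip (Fin.tail a)) (X (a 0))
    rw [Module.End.mul_apply, LinearMap.smul_apply, Module.End.mul_apply] at e
    change τ (C.steps (fun j => parity (Fin.tail a j)) (X (parity (a 0)))).1 = _
    rw [hX.parity_eq, e, flip_apply, Prod.smul_fst, map_smul, h.parity_eq, smul_eq_mul, pow_add,
      mul_assoc]
    rfl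

end NCChain

/-! ### Descent to the quotient `A = Ω / F_{-1} Ω` -/

namespace SuperFiltration

open TwistedCyclic CyclicCohomology

variable {Ω : Type*} [NonUnitalRing Ω] [Module ℂ Ω] [TopologicalSpace Ω] [SuperAlgebra Ω]
  (𝓕 : SuperFiltration Ω)

theorem proj_smul (c : ℂ) (a : Ω) : 𝓕.proj (c • a) = c • 𝓕.proj a := rfl

theorem proj_parity (a : Ω) : 𝓕.proj (parity a) = parity (𝓕.proj a) := rfl

theorem proj_eq_iff {a b : Ω} : 𝓕.proj a = 𝓕.proj b ↔ a - b ∈ 𝓕.F 1 := Submodule.Quotient.eq _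

instance [IsScalarTower ℂ Ω Ω] : IsScalarTower ℂ 𝓕.A 𝓕.A where
  smul_assoc c x y := by
    obtain ⟨a, rfl⟩ := 𝓕.proj_surjective x
    obtain ⟨b, rfl⟩ := 𝓕.proj_surjective y
    exact congrArg 𝓕.proj (smul_mul_assoc c a b)

instance [SMulCommClass ℂ Ω Ω] : SMulCommClass ℂ 𝓕.A 𝓕.A where
  smul_comm c x y := by
    obtain ⟨a, rfl⟩ := 𝓕.proj_surjective x
    obtain ⟨b, rfl⟩ := 𝓕.proj_surjective y
    exact congrArg 𝓕.proj (mul_smul_comm c a b).symm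

/-! ### The quotient topology on `A`. -/

section Topology

variable [IsTopologicalRing Ω]

theorem isOpenQuotientMap_proj : IsOpenQuotientMap 𝓕.proj :=
  (𝓕.F 1).isOpenQuotientMap_mkQ

instance : ContinuousMul 𝓕.A where
  continuous_mul := by
    refine (𝓕.isOpenQuotientMap_proj.prodMap 𝓕.isOpenQuotientMap_proj).isQuotientMap.continuous_iff.2
      ?_
    exact 𝓕.isOpenQuotientMap_proj.continuous.comp continuous_mul

variable {𝓕}

/-- A function of tuples in `A` is a cochain if it comes from a cochain on `Ω`. -/
theorem mem_cochains_of_comp_proj {n : ℕ} {g : (Fin (n + 1) → 𝓕.A) → ℂ}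
    (h : (fun a : Fin (n + 1) → Ω => g fun k => 𝓕.proj (a k)) ∈ cochains Ω n) :
    g ∈ cochains 𝓕.A n := by
  obtain ⟨f, hf⟩ := h
  have hs : ∀ x : Fin (n + 1) → 𝓕.A, ∃ a : Fin (n + 1) → Ω, (fun k => 𝓕.proj (a k)) = x :=
    fun x => ⟨fun k => (𝓕.proj_surjective (x k)).choose,
      funext fun k => (𝓕.proj_surjective (x k)).choose_spec⟩
  have hu : ∀ (a : Fin (n + 1) → Ω) i y, Function.update (fun k => 𝓕.proj (a k)) i (𝓕.proj y) =
      fun k => 𝓕.proj (Function.update a i y k) :=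
    fun a i y => (Function.comp_update 𝓕.proj a i y).symm
  have hfa : ∀ a, g (fun k => 𝓕.proj (a k)) = f a := fun a => (congrFun hf a).symm
  refine ⟨⟨MultilinearMap.mk' g (fun x i u v => ?_) (fun x i c u => ?_), ?_⟩, rfl⟩
  · obtain ⟨a, rfl⟩ := hs x
    obtain ⟨u, rfl⟩ := 𝓕.proj_surjective u
    obtain ⟨v, rfl⟩ := 𝓕.proj_surjective v
    rw [← proj_add]
    simp only [hu, hfa, f.map_update_add]
  · obtain ⟨a, rfl⟩ := hs x
    obtain ⟨u, rfl⟩ := 𝓕.proj_surjective u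
    rw [← proj_smul]
    simp only [hu, hfa, f.map_update_smul]
  -- Openness of the projection matters: products of open quotient maps are again quotient maps, so
  -- continuity can be tested upstairs.
  · refine (IsOpenQuotientMap.piMap fun _ : Fin (n + 1) =>
      𝓕.isOpenQuotientMap_proj).isQuotientMap.continuous_iff.2 ?_
    have : g ∘ Pi.map (fun _ => 𝓕.proj) = f := hf.symm
    change Continuous (g ∘ _)
    rw [this]
    exact f.cont

end Topology

variable {𝓕}

/-- A cochain that vanishes if one of its arguments is in `F_{-1}` depends only on the residue
classes of its arguments. -/
theorem eq_of_proj_eq {n : ℕ} {f : (Fin (n + 1) → Ω) → ℂ} (hf : f ∈ cochains Ω n)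
    (h0 : ∀ a j, a j ∈ 𝓕.F 1 → f a = 0) {a c : Fin (n + 1) → Ω}
    (hac : ∀ k, 𝓕.proj (a k) = 𝓕.proj (c k)) : f a = f c := by
  obtain ⟨g, rfl⟩ := hf
  -- The arguments are exchanged one at a time; each exchange changes the value by f of a tuple with
  -- an entry in F_{-1}.
  have key : ∀ s : Finset (Fin (n + 1)), g (s.piecewise a c) = g c := by
    intro s
    induction s using Finset.induction_on with
    | empty => rw [Finset.piecewise_empty]
    | insert j s hj ih =>
      rw [Finset.piecewise_insert, ← ih, ← sub_eq_zero]
      have e : s.piecewise a c = Function.update (s.piecewise a c) j (c j) := by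
        conv_lhs => rw [← Function.update_eq_self j (s.piecewise a c)]
        rw [Finset.piecewise_eq_of_notMem _ _ _ hj]
      conv_lhs => rw [e, Function.update_idem, ← g.map_update_sub]
      exact h0 _ j (by rw [Function.update_self]; exact (𝓕.proj_eq_iff).1 (hac j))
  simpa using key Finset.univ

theorem tb_comp_proj {n : ℕ} (s : ℕ) (g : (Fin (n + 1) → 𝓕.A) → ℂ) (a : Fin (n + 2) → Ω) :
    tb parity^[s] g (fun k => 𝓕.proj (a k)) =
      tb parity^[s] (fun c : Fin (n + 1) → Ω => g fun k => 𝓕.proj (c k)) a := by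
  have hc : ∀ (i : Fin (n + 2)) (c : Fin (n + 2) → Ω), contract i (fun k => 𝓕.proj (c k)) =
      fun k => 𝓕.proj (contract i c k) := fun i c =>
    (Fin.comp_contractNth (· * ·) (· * ·) (f := 𝓕.proj) (fun _ _ => rfl) i c).symm
  have hr : tcons (parity^[s] (𝓕.proj (a (Fin.last (n + 1))))) (Fin.init fun k => 𝓕.proj (a k)) =
      fun k => 𝓕.proj (tcons (parity^[s] (a (Fin.last (n + 1)))) (Fin.init a) k) := by
    funext k
    refine Fin.cases ?_ (fun k => rfl) k
    exact (Function.Semiconj.iterate_right (f := 𝓕.proj) (fun x => 𝓕.proj_parity x) s _).symm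
  rw [tb, tb, hr, hc]
  simp only [bar, hc]

theorem lam_comp_proj {n : ℕ} (s : ℕ) (g : (Fin (n + 1) → 𝓕.A) → ℂ) (a : Fin (n + 1) → Ω) :
    lam parity^[s] g (fun k => 𝓕.proj (a k)) =
      lam parity^[s] (fun c : Fin (n + 1) → Ω => g fun k => 𝓕.proj (c k)) a := by
  rw [lam, lam]
  congr 2
  funext k
  refine Fin.cases ?_ (fun k => rfl) k
  exact (Function.Semiconj.iterate_right (f := 𝓕.proj) (fun x => 𝓕.proj_parity x) s _).symm

theorem mu_iterate_comp_proj {n : ℕ} (s j : ℕ) (g : (Fin (n + 1) → 𝓕.A) → ℂ)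
    (a : Fin (n + 1) → Ω) : (mu parity^[s])^[j] g (fun k => 𝓕.proj (a k)) =
      (mu parity^[s])^[j] (fun c : Fin (n + 1) → Ω => g fun k => 𝓕.proj (c k)) a := by
  induction j generalizing g with
  | zero => rfl
  | succ j ih =>
    rw [Function.iterate_succ_apply, Function.iterate_succ_apply, ih]
    refine congrFun (congrArg _ (funext fun c => ?_)) a
    rw [mu, mu]
    congr 2
    funext k
    refine Fin.lastCases ?_ (fun k => ?_) k
    · rw [tsnoc_last, tsnoc_last]
      exact (Function.Semiconj.iterate_right (f := 𝓕.proj) (fun x => 𝓕.proj_parity x) s _).symm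
    · simp only [tsnoc, Fin.snoc_castSucc]
      rfl

end SuperFiltration

/-! ### The functionals and their identities on `A`. -/

namespace NCChain

open TwistedCyclic CyclicCohomology SuperFiltration

variable {Ω : Type*} [NonUnitalRing Ω] [Module ℂ Ω] [TopologicalSpace Ω] [SuperAlgebra Ω]
  {𝓕 : SuperFiltration Ω} [IsScalarTower ℂ Ω Ω] [SMulCommClass ℂ Ω Ω] [IsTopologicalRing Ω]
  {C : NCChain 𝓕} {p n : ℕ} {τ : Ω →L[ℂ] ℂ} {X : Ω →ₗ[ℂ] Ω × Ω} {ρ : 𝓕.A → Ω}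

theorem functional_lift (h : C.ClosedTrace p τ) (hn : ∀ x ∈ 𝓕.F (n + 1), τ x = 0)
    (hX : Start 𝓕 X) (hρ : ∀ x, 𝓕.proj (ρ x) = x) (a : Fin (n + 1) → Ω) :
    C.functional τ X n (fun k => ρ (𝓕.proj (a k))) = C.functional τ X n a :=
  eq_of_proj_eq (functional_mem_homogeneousCochains h hX).1
    (fun _ _ hj => functional_eq_zero hX hn hj) fun _ => hρ _

theorem functional_lift_mem (h : C.ClosedTrace p τ) (hn : ∀ x ∈ 𝓕.F (n + 1), τ x = 0)
    (hX : Start 𝓕 X) (hρ : ∀ x, 𝓕.proj (ρ x) = x) :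
    (fun x : Fin (n + 1) → 𝓕.A => C.functional τ X n fun k => ρ (x k)) ∈
      homogeneousCochains 𝓕.A (n + p) n := by
  have hf := functional_mem_homogeneousCochains (n := n) h hX
  constructor
  · refine mem_cochains_of_comp_proj ?_
    simp only [functional_lift h hn hX hρ]
    exact hf.1
  · intro x
    rw [← hf.2]
    refine eq_of_proj_eq hf.1 (fun _ _ hj => functional_eq_zero hX hn hj) fun k => ?_
    rw [hρ, proj_parity, hρ]

/-- A lifting need not be additive or multiplicative. Since the functional depends only on residue
classes, the coboundary can nevertheless be computed on representatives in Ω. -/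
theorem tb_functional_lift (h : C.ClosedTrace p τ) (hn : ∀ x ∈ 𝓕.F (n + 1), τ x = 0)
    (hX : Start 𝓕 X) (hXt : ∀ x y, X (x * y) = tact x (X y)) (hρ : ∀ x, 𝓕.proj (ρ x) = x)
    (x : Fin (n + 2) → 𝓕.A) :
    tb parity^[n + p + 1] (fun x : Fin (n + 1) → 𝓕.A => C.functional τ X n fun k => ρ (x k)) x =
      C.functional τ X n (contract 0 fun k => ρ (x k)) -
      τ (C.steps (Fin.tail (Fin.tail fun k => ρ (x k))) (cut (ρ (x 1)) (X (ρ (x 0))))).1 := by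
  have e : x = fun k => 𝓕.proj (ρ (x k)) := funext fun k => (hρ _).symm
  conv_lhs => rw [e, tb_comp_proj]
  simp only [functional_lift h hn hX hρ]
  exact h.tb_functional X hXt _

theorem functional_inl_mem_cyclicCocycles (h : C.ClosedTrace p τ)
    (hn : ∀ x ∈ 𝓕.F (n + 1), τ x = 0) (hρ : ∀ x, 𝓕.proj (ρ x) = x) :
    (fun x : Fin (n + 1) → 𝓕.A => C.functional τ (LinearMap.inl ℂ Ω Ω) n fun k => ρ (x k)) ∈
      cyclicCocycles 𝓕.A n := by
  rw [mem_cyclicCocycles_iff (functional_lift_mem h hn start_inl hρ)]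
  constructor
  · funext x
    have e : x = fun k => 𝓕.proj (ρ (x k)) := funext fun k => (hρ _).symm
    conv_lhs => rw [e, lam_comp_proj]
    simp only [functional_lift h hn start_inl hρ]
    exact congrFun (h.lam_functional n) _
  · funext x
    rw [tb_functional_lift h hn start_inl (fun x y => by simp [tact]) hρ]
    obtain ⟨x0, x, rfl⟩ := exists_tcons x
    obtain ⟨x1, x, rfl⟩ := exists_tcons x
    have e : ∀ (y z : 𝓕.A) l, (fun k => ρ (tcons y (tcons z l) k)) =
        tcons (ρ y) (tcons (ρ z) fun k : Fin n => ρ (l k)) := fun y z l => by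
      funext k
      refine Fin.cases rfl (fun k => ?_) k
      exact Fin.cases rfl (fun k => rfl) k
    rw [e, contract_zero]
    exact sub_self _

theorem tb_functional_slotStart_lift (h : C.ClosedTrace p τ) (hn : ∀ x ∈ 𝓕.F (n + 1), τ x = 0)
    {η : Ω} (hη : η ∈ 𝓕.F 1) (ho : parity η = -η) (hρ : ∀ x, 𝓕.proj (ρ x) = x)
    (x : Fin (n + 2) → 𝓕.A) :
    tb parity^[n + p + 1] (fun x : Fin (n + 1) → 𝓕.A =>
      C.functional τ (slotStart η) n fun k => ρ (x k)) x =
      C.functional τ (slotStart η) n fun k => ρ (contract 0 x k) := by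
  have hX := start_slotStart hη ho
  have hXt : ∀ x y, slotStart η (x * y) = tact x (slotStart η y) := fun x y => by
    simp [slotStart, slot_apply, tact, parity_mul, mul_assoc]
  rw [tb_functional_lift h hn hX hXt hρ]
  have e : cut (ρ (x 1)) (slotStart η (ρ (x 0))) = 0 := by
    simp [slotStart, slot_apply, cut_apply]
  rw [e, map_zero, Prod.fst_zero, map_zero, sub_zero]
  refine eq_of_proj_eq (functional_mem_homogeneousCochains h hX).1
    (fun _ _ hj => functional_eq_zero hX hn hj) fun k => ?_
  rw [hρ]
  have := congrFun (Fin.comp_contractNth (· * ·) (· * ·) (f := 𝓕.proj) (fun _ _ => rfl) 0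
    fun k => ρ (x k)) k
  refine this.trans (congrArg (fun y : Fin (n + 2) → 𝓕.A => contract 0 y k) ?_)
  exact funext fun k => hρ _

theorem dfunctional_lift_eq_sum (h : C.ClosedTrace p τ) (hn : ∀ x ∈ 𝓕.F (n + 1), τ x = 0)
    {η : Ω} (hη : η ∈ 𝓕.F 1) (ho : parity η = -η) (hρ : ∀ x, 𝓕.proj (ρ x) = x) :
    (fun x : Fin (n + 1) → 𝓕.A => C.dfunctional τ η n fun k => ρ (x k)) =
      ∑ j ∈ Finset.range (n + 1), (mu parity^[n + p + 1])^[j]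
        fun x : Fin (n + 1) → 𝓕.A => C.functional τ (slotStart η) n fun k => ρ (x k) := by
  have hX := start_slotStart hη ho
  funext x
  have e : x = fun k => 𝓕.proj (ρ (x k)) := funext fun k => (hρ _).symm
  conv_rhs => rw [e, Finset.sum_apply]
  simp only [mu_iterate_comp_proj, functional_lift h hn hX hρ]
  rw [h.dfunctional_eq_sum ho n, Finset.sum_apply]

end NCChain

/-! ### Polynomial families and their derivatives -/

/-- `f'` is the derivative of the polynomial `f` in one complex variable with coefficients in `V`. -/
inductive PolyDeriv {V : Type*} [AddCommGroup V] [Module ℂ V] : (ℂ → V) → (ℂ → V) → Prop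
  | const (v : V) : PolyDeriv (fun _ => v) (fun _ => 0)
  | add {f f' g g' : ℂ → V} : PolyDeriv f f' → PolyDeriv g g' →
      PolyDeriv (fun t => f t + g t) (fun t => f' t + g' t)
  | smul {f f' : ℂ → V} : PolyDeriv f f' → PolyDeriv (fun t => t • f t) (fun t => f t + t • f' t)

namespace PolyDeriv

variable {V V' W : Type*} [AddCommGroup V] [Module ℂ V] [AddCommGroup V'] [Module ℂ V']
  [AddCommGroup W] [Module ℂ W] {f f' : ℂ → V}

theorem map (h : PolyDeriv f f') (T : V →ₗ[ℂ] W) :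
    PolyDeriv (fun t => T (f t)) (fun t => T (f' t)) := by
  induction h with
  | const v => simpa using const (T v)
  | add _ _ h1 h2 => simpa using add h1 h2
  | smul _ h1 => simpa using smul h1

theorem map₂ (h : PolyDeriv f f') {g g' : ℂ → V'} (hg : PolyDeriv g g') (B : V →ₗ[ℂ] V' →ₗ[ℂ] W) :
    PolyDeriv (fun t => B (f t) (g t)) (fun t => B (f' t) (g t) + B (f t) (g' t)) := by
  induction h with
  | const v => simpa using hg.map (B v)
  | add _ _ h1 h2 =>
    have := add h1 h2
    simp only [map_add, LinearMap.add_apply]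
    simpa only [add_add_add_comm] using this
  | smul _ h1 =>
    have := smul h1
    simp only [map_smul, map_add, LinearMap.smul_apply, LinearMap.add_apply]
    simpa only [smul_add, add_assoc] using this

theorem hasDerivAt {f f' : ℂ → ℂ} (h : PolyDeriv f f') (t : ℂ) : HasDerivAt f (f' t) t := by
  induction h with
  | const v => exact hasDerivAt_const t v
  | add _ _ h1 h2 => exact h1.add h2
  | smul _ h1 => exact ((hasDerivAt_id t).mul h1).congr_deriv (by simp)

/-- A vector outside U is separated from U by a purely algebraic linear functional, so the claim
reduces to scalar polynomials. Thus U need not be closed for any topology. -/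
theorem deriv_mem (h : PolyDeriv f f') {U : Submodule ℂ V} (hU : ∀ t, f t ∈ U) (t : ℂ) :
    f' t ∈ U := by
  by_contra hx
  obtain ⟨T, hT, hTU⟩ := Submodule.exists_le_ker_of_notMem hx
  have h1 := (h.map T).hasDerivAt t
  have h2 : (fun t => T (f t)) = fun _ => 0 := funext fun t => hTU (hU t)
  rw [h2] at h1
  exact hT (h1.unique (hasDerivAt_const t 0))

/-- Separating by a linear functional that kills U leaves a scalar function with zero derivative,
which is constant. This form of integration also applies to the space of coboundaries, about whose
closure nothing is known. -/
theorem sub_mem (h : PolyDeriv f f') {U : Submodule ℂ V} (hU : ∀ t, f' t ∈ U) (s t : ℂ) :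
    f s - f t ∈ U := by
  by_contra hx
  obtain ⟨T, hT, hTU⟩ := Submodule.exists_le_ker_of_notMem hx
  have h1 := fun t => (h.map T).hasDerivAt t
  have h2 : ∀ t, T (f' t) = 0 := fun t => hTU (hU t)
  simp only [h2] at h1
  refine hT ?_
  rw [map_sub, sub_eq_zero]
  exact is_const_of_deriv_eq_zero (fun t => (h1 t).differentiableAt) (fun t => (h1 t).deriv) s t

end PolyDeriv

/-! ### The family of connections `∇ + t ad_η` -/

namespace NCCycle

open TwistedCyclic CyclicCohomology NCChain

variable {Ω : Type*} [NonUnitalRing Ω] [Module ℂ Ω] [TopologicalSpace Ω] [SuperAlgebra Ω]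
  {𝓕 : SuperFiltration Ω} [IsScalarTower ℂ Ω Ω] [SMulCommClass ℂ Ω Ω] [IsTopologicalRing Ω]
  (C : NCCycle 𝓕) {η : Ω} (hη : η ∈ 𝓕.F 1) (ho : HasParity 1 η)

theorem hasParity_smul (ho : HasParity 1 η) (t : ℂ) : HasParity 1 (t • η) := by
  unfold HasParity at *
  rw [map_smul, ho, smul_comm]

/-- The cycle with connection `∇ + t ad_η`. -/
noncomputable def family (t : ℂ) : NCCycle 𝓕 :=
  C.perturb (t • η) (Submodule.smul_mem _ t hη) (hasParity_smul ho t)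

/-- The coefficient of `t²` in `step`. -/
def stepSq (η a : Ω) : Module.End ℂ (Ω × Ω) where
  toFun v := (0, -(v.1 * a * (η * η)))
  map_add' v w := by simp [add_mul]; abel
  map_smul' c v := by simp [smul_mul_assoc]

/-- The connection is affine in t, while the curvature ω + t∇η + t²η² is quadratic; this is the
source of `stepSq`. -/
theorem step_family (t : ℂ) (a : Ω) : (C.family hη ho t).step a =
    C.step a + t • (C.dstep η a + t • stepSq η a) := by
  have ho' : parity η = -η := by simpa [HasParity] using ho
  refine LinearMap.ext fun v => ?_
  have e1 : (C.family hη ho t).nabla a = C.nabla a + (t • η * a - parity a * (t • η)) := rfl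
  have e2 : ∀ x, (C.family hη ho t).curvR x =
      C.curvR x + x * (C.nabla (t • η) + t • η * t • η) := fun x => rfl
  simp only [LinearMap.add_apply, LinearMap.smul_apply, step_apply, dstep_apply, e1, e2]
  refine Prod.ext ?_ ?_
  · simp [stepSq, mul_add, mul_sub, smul_sub, smul_mul_assoc, mul_smul_comm]
    abel
  · simp [stepSq, mul_add, smul_add, mul_assoc, smul_mul_assoc, mul_smul_comm]
    abel

/-- Because ad_{tη} η = 2tη², `dstep` of the cycle at t is the derivative in t of `step_family`.
Hence the analysis for a fixed cycle applies at every t. -/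
theorem dstep_family (t : ℂ) (a : Ω) : (C.family hη ho t).dstep η a =
    C.dstep η a + t • stepSq η a + t • stepSq η a := by
  have ho' : parity η = -η := by simpa [HasParity] using ho
  refine LinearMap.ext fun v => ?_
  have e1 : (C.family hη ho t).nabla η = C.nabla η + (t • η * η - parity η * (t • η)) := rfl
  simp only [LinearMap.add_apply, LinearMap.smul_apply, dstep_apply, e1, ho']
  refine Prod.ext ?_ ?_
  · simp [stepSq]
  · simp [stepSq, mul_add, mul_assoc, smul_mul_assoc, mul_smul_comm]
    abel

/-- The index set `I` lets the derivative be taken of an entire cochain at once, with the tuples of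
arguments as indices. -/
theorem polyDeriv_steps {k : ℕ} {I : Type*} (a : I → Fin k → Ω) :
    PolyDeriv (fun t i => (C.family hη ho t).steps (a i))
      fun t i => (C.family hη ho t).dsteps η (a i) := by
  induction k with
  | zero => exact PolyDeriv.const (V := I → Module.End ℂ (Ω × Ω)) fun _ => 1
  | succ k ih =>
    have h1 := ih fun i => Fin.tail (a i)
    have h2 : PolyDeriv (fun t i => (C.family hη ho t).step (a i 0))
        fun t i => (C.family hη ho t).dstep η (a i 0) := by
      have := PolyDeriv.add (.const fun i => C.step (a i 0)) (.smul (.add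
        (.const fun i => C.dstep η (a i 0)) (.smul (.const fun i => stepSq η (a i 0)))))
      convert this using 1
      · funext t i
        exact C.step_family hη ho t (a i 0)
      · funext t i
        rw [dstep_family]
        simp [add_assoc]
    exact h1.map₂ h2 (LinearMap.mul ℂ (I → Module.End ℂ (Ω × Ω)))

theorem polyDeriv_functional (τ : Ω →L[ℂ] ℂ) {n : ℕ} {I : Type*} (a : I → Fin (n + 1) → Ω) :
    PolyDeriv (fun t i => (C.family hη ho t).functional τ (LinearMap.inl ℂ Ω Ω) n (a i))
      fun t i => (C.family hη ho t).dfunctional τ η n (a i) :=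
  (C.polyDeriv_steps hη ho fun i => Fin.tail (a i)).map
    (T := LinearMap.pi fun i => τ.toLinearMap ∘ₗ LinearMap.fst ℂ Ω Ω ∘ₗ
      LinearMap.applyₗ (a i 0, 0) ∘ₗ LinearMap.proj i)

end NCCycle

namespace CyclicCohomology

variable {A : Type*} [NonUnitalRing A] [Module ℂ A] [TopologicalSpace A]

/-- The periodicity operator as a linear map. -/
noncomputable def linearS (n : ℕ) :
    ((Fin (n + 1) → A) → ℂ) →ₗ[ℂ] ((Fin (n + 3) → A) → ℂ) where
  toFun := S
  map_add' f g := by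
    funext a
    simp only [S, Pi.add_apply, mul_add, ← Finset.sum_add_distrib]
    refine Finset.sum_congr rfl fun j _ => Finset.sum_congr rfl fun i _ => ?_
    split_ifs <;> simp
  map_smul' c f := by
    funext a
    simp only [S, Pi.smul_apply, smul_eq_mul, Finset.mul_sum, RingHom.id_apply]
    refine Finset.sum_congr rfl fun j _ => Finset.sum_congr rfl fun i _ => ?_
    split_ifs <;> ring

end CyclicCohomology

/-! ### Integration along the family and conclusion. -/

namespace NCCycle

open CyclicCohomology NCChain

variable {Ω : Type*} [NonUnitalRing Ω] [Module ℂ Ω] [TopologicalSpace Ω] [SuperAlgebra Ω]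
  {𝓕 : SuperFiltration Ω} [IsScalarTower ℂ Ω Ω] [SMulCommClass ℂ Ω Ω] [IsTopologicalRing Ω]
  (C : NCCycle 𝓕)

/-- The homogeneous part of degree `p` of the cocycle of a cycle, up to a sign. -/
noncomputable def cocyclePart (p n : ℕ) (ρ : 𝓕.A → Ω) (x : Fin (n + 1) → 𝓕.A) : ℂ :=
  C.functional (tracePart p C.tau) (LinearMap.inl ℂ Ω Ω) n fun k => ρ (x k)

theorem cocycle_eq (n : ℕ) (ρ : 𝓕.A → Ω) :
    C.cocycle n ρ = formSign n • (C.cocyclePart 0 n ρ + C.cocyclePart 1 n ρ) := by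
  funext x
  rw [cocycle, character_eq]
  exact congrArg _ (tracePart_zero_add_one C.tau _).symm

variable {C} {p n : ℕ} {ρ ρ' : 𝓕.A → Ω}

theorem cocyclePart_mem (hn : ∀ a ∈ 𝓕.F (n + 1), C.tau a = 0) (hρ : ∀ x, 𝓕.proj (ρ x) = x) :
    C.cocyclePart p n ρ ∈ homogeneousCochains 𝓕.A (n + p) n ⊓ cyclicCocycles 𝓕.A n :=
  ⟨functional_lift_mem (C.closedTrace p) (tracePart_eq_zero hn) start_inl hρ,
    functional_inl_mem_cyclicCocycles (C.closedTrace p) (tracePart_eq_zero hn) hρ⟩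

theorem cocyclePart_congr (hn : ∀ a ∈ 𝓕.F (n + 1), C.tau a = 0) (hρ : ∀ x, 𝓕.proj (ρ x) = x)
    (hρ' : ∀ x, 𝓕.proj (ρ' x) = x) : C.cocyclePart p n ρ = C.cocyclePart p n ρ' := by
  funext x
  have := functional_lift (C.closedTrace p) (tracePart_eq_zero hn) start_inl hρ fun k => ρ' (x k)
  simp only [hρ'] at this
  exact this

theorem cocycle_mem (hn : ∀ a ∈ 𝓕.F (n + 1), C.tau a = 0) (hρ : ∀ x, 𝓕.proj (ρ x) = x) :
    C.cocycle n ρ ∈ cyclicCocycles 𝓕.A n ∧ S (C.cocycle n ρ) ∈ cyclicCocycles 𝓕.A (n + 2) := by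
  have h := fun p => cocyclePart_mem (p := p) hn hρ
  have hS := fun p => S_mem_cyclicCocycles (h p).1 (h p).2
  rw [cocycle_eq]
  refine ⟨Submodule.smul_mem _ _ (add_mem (h 0).2 (h 1).2), ?_⟩
  have e : S (formSign n • (C.cocyclePart 0 n ρ + C.cocyclePart 1 n ρ)) =
      formSign n • (S (C.cocyclePart 0 n ρ) + S (C.cocyclePart 1 n ρ)) :=
    ((linearS n).map_smul _ _).trans (congrArg _ ((linearS n).map_add _ _))
  rw [e]
  exact Submodule.smul_mem _ _ (add_mem (hS 0) (hS 1))

theorem family_zero_cocyclePart {η : Ω} (hη : η ∈ 𝓕.F 1) (ho : HasParity 1 η) :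
    (C.family hη ho 0).cocyclePart p n ρ = C.cocyclePart p n ρ := by
  have hs : (C.family hη ho 0).step = C.step := funext fun a => by
    rw [step_family, zero_smul, add_zero]
  have h : ∀ {k : ℕ} (a : Fin k → Ω), (C.family hη ho 0).steps a = C.steps a := by
    intro k a
    induction k with
    | zero => rfl
    | succ k ih => rw [steps, steps, ih, hs]
  funext x
  rw [cocyclePart, cocyclePart, functional, functional, h]
  rfl

theorem family_one {η : Ω} (hη : η ∈ 𝓕.F 1) (ho : HasParity 1 η) :
    C.family hη ho 1 = C.perturb η hη ho := by
  have h : ∀ ζ (hζ : ζ ∈ 𝓕.F 1) (hoζ : HasParity 1 ζ), ζ = η →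
      C.perturb ζ hζ hoζ = C.perturb η hη ho := by
    rintro _ _ _ rfl
    rfl
  exact h _ _ _ (one_smul ℂ η)

/-- The derivative of the homogeneous part of degree `p` of the cocycle along `ad_η`. -/
noncomputable def dcocyclePart (C : NCCycle 𝓕) (p n : ℕ) (ρ : 𝓕.A → Ω) (η : Ω)
    (x : Fin (n + 1) → 𝓕.A) : ℂ :=
  C.dfunctional (tracePart p C.tau) η n fun k => ρ (x k)

theorem S_dcocyclePart_mem_cyclicCoboundaries (hn : ∀ a ∈ 𝓕.F (n + 1), C.tau a = 0)
    (hρ : ∀ x, 𝓕.proj (ρ x) = x) {η : Ω} (hη : η ∈ 𝓕.F 1) (ho : parity η = -η)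
    (hm : C.dcocyclePart p n ρ η ∈ homogeneousCochains 𝓕.A (n + p) n ⊓ cyclicCocycles 𝓕.A n) :
    S (C.dcocyclePart p n ρ η) ∈ cyclicCoboundaries 𝓕.A (n + 2) :=
  have hc := C.closedTrace p
  have hn' := tracePart_eq_zero (p := p) hn
  S_mem_cyclicCoboundaries hm.1 hm.2 (functional_lift_mem hc hn' (start_slotStart hη ho) hρ)
    (fun x => tb_functional_slotStart_lift hc hn' hη ho hρ x)
    (dfunctional_lift_eq_sum hc hn' hη ho hρ)

theorem polyDeriv_cocyclePart {η : Ω} (hη : η ∈ 𝓕.F 1) (ho : HasParity 1 η) :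
    PolyDeriv (fun t => (C.family hη ho t).cocyclePart p n ρ)
      fun t => (C.family hη ho t).dcocyclePart p n ρ η :=
  C.polyDeriv_functional hη ho (tracePart p C.tau) fun (x : Fin (n + 1) → 𝓕.A) k => ρ (x k)

theorem S_cocyclePart_sub_mem (hn : ∀ a ∈ 𝓕.F (n + 1), C.tau a = 0)
    (hρ : ∀ x, 𝓕.proj (ρ x) = x) {η : Ω} (hη : η ∈ 𝓕.F 1) (ho : HasParity 1 η) :
    S (C.cocyclePart p n ρ) - S ((C.perturb η hη ho).cocyclePart p n ρ) ∈
      cyclicCoboundaries 𝓕.A (n + 2) := by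
  have ho' : parity η = -η := by simpa [HasParity] using ho
  have hd := polyDeriv_cocyclePart (C := C) (p := p) (n := n) (ρ := ρ) hη ho
  -- All members of the family are homogeneous cyclic cocycles, so their derivative is one too.
  have hm := hd.deriv_mem fun t => cocyclePart_mem (C := C.family hη ho t) hn hρ
  have hS := (hd.map (linearS n)).sub_mem (U := cyclicCoboundaries 𝓕.A (n + 2)) (fun t =>
    S_dcocyclePart_mem_cyclicCoboundaries (C := C.family hη ho t) hn hρ hη ho' (hm t)) 0 1
  rw [family_zero_cocyclePart, family_one] at hS
  exact hS

theorem S_cocycle_sub_mem (hn : ∀ a ∈ 𝓕.F (n + 1), C.tau a = 0)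
    (hρ : ∀ x, 𝓕.proj (ρ x) = x) (hρ' : ∀ x, 𝓕.proj (ρ' x) = x)
    {η : Ω} (hη : η ∈ 𝓕.F 1) (ho : HasParity 1 η) :
    S (C.cocycle n ρ) - S ((C.perturb η hη ho).cocycle n ρ') ∈
      cyclicCoboundaries 𝓕.A (n + 2) := by
  have h := fun p => S_cocyclePart_sub_mem (p := p) hn hρ hη ho
  -- The lifting of the second cocycle is replaced by that of the first, so that both lie on one
  -- family.
  rw [cocycle_eq, cocycle_eq, cocyclePart_congr (C := C.perturb η hη ho) hn hρ' hρ,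
    cocyclePart_congr (C := C.perturb η hη ho) (p := 1) hn hρ' hρ]
  have := Submodule.smul_mem _ (formSign n) (add_mem (h 0) (h 1))
  convert this using 1
  change linearS n _ - linearS n _ = _ • (linearS n _ - linearS n _ + (linearS n _ - linearS n _))
  simp only [map_smul, map_add]
  module

end NCCycle

open CyclicCohomology in
theorem mainTheorem5 {Ω : Type*} [NonUnitalRing Ω] [Module ℂ Ω] [IsScalarTower ℂ Ω Ω]
    [SMulCommClass ℂ Ω Ω] [TopologicalSpace Ω] [IsTopologicalRing Ω] [ContinuousSMul ℂ Ω]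
    [LocallyConvexSpace ℝ Ω] [SuperAlgebra Ω] (𝓕 : SuperFiltration Ω) (C : NCCycle 𝓕)
    (η : Ω) (hη : η ∈ 𝓕.F 1) (hodd : HasParity 1 η)
    (n : ℕ) (hn : ∀ a ∈ 𝓕.F (n + 1), C.tau a = 0)
    (ρ₀ ρ₁ : 𝓕.A → Ω) (hρ₀ : ∀ x, 𝓕.proj (ρ₀ x) = x) (hρ₁ : ∀ x, 𝓕.proj (ρ₁ x) = x)
    (φ₀ φ₁ : (Fin (n + 1) → 𝓕.A) → ℂ) (hφ₀ : φ₀ = C.cocycle n ρ₀)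
    (hφ₁ : φ₁ = (C.perturb η hη hodd).cocycle n ρ₁) :
    φ₀ ∈ cyclicCocycles 𝓕.A n ∧ φ₁ ∈ cyclicCocycles 𝓕.A n ∧
      ∃ (h₀ : S φ₀ ∈ cyclicCocycles 𝓕.A (n + 2)) (h₁ : S φ₁ ∈ cyclicCocycles 𝓕.A (n + 2)),
        HC.mk (S φ₀) h₀ = HC.mk (S φ₁) h₁ := by
  subst hφ₀ hφ₁
  obtain ⟨hc₀, hS₀⟩ := NCCycle.cocycle_mem hn hρ₀
  obtain ⟨hc₁, hS₁⟩ := NCCycle.cocycle_mem (C := C.perturb η hη hodd) hn hρ₁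
  refine ⟨hc₀, hc₁, hS₀, hS₁, (Submodule.Quotient.eq _).2 ?_⟩
  exact NCCycle.S_cocycle_sub_mem hn hρ₀ hρ₁ hη hodd
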